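/- Notation. A weight is a nonnegative measurable function $w$ on $(0,\infty)$ with $W(t):=\int_0^t w(s)\,ds<\infty$ for every $t>0$; "decreasing" means nonincreasing, and for decreasing $w$ we put $w(\infty)=\lim_{t\to\infty}w(t)$. Let $n\ge 1$. For a measurable $f:\mathbb R^n\to[0,\infty)$ let $f^*$ be its decreasing rearrangement and $f^{**}(t)=\frac1t\int_0^t f^*(s)\,ds$. Put $$\|f\|_{\Lambda^1(w)}=\int_0^\infty f^*(t)w(t)\,dt,\qquad \|f\|_{\Gamma^q(w)}=\Big(\int_0^\infty f^{**}(t)^q w(t)\,dt\Big)^{1/q},$$ $$\|f\|_{\Gamma^{1,\infty}(w)}=\sup_{t>0}f^{**}(t)W(t),\qquad \|f\|_{\Gamma^q_1(w)}=\Big(\int_0^\infty f^*(t)f^{**}(t)^{q-1}w(t)\,dt\Big)^{1/q},$$ and let $\Lambda^1(w)$, $\Gamma^q(w)$, $\Gamma^{1,\infty}(w)$, $\Gamma^q_1(w)$ be the sets of measurable $f:\mathbb R^n\to[0,\infty)$ for which the respective quantity is finite. We write $A\approx B$ if $C^{-1}A\le B\le CA$ with a finite constant $C>0$ independent of the free variable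 ($f$, respectively $r>0$). Proposition. Let $w$ be a decreasing weight and $1<q<\infty$. (a) If $v$ is a weight with $\Lambda^1(w)\subset\Gamma^q(v)\subset\Gamma^{1,\infty}(w)$ (inclusion of sets), then $$\int_0^\infty f^{**}(x)^q v(x)\,dx\approx\int_0^\infty f^*(x)f^{**}(x)^{q-1}W(x)^{q-1}w(x)\,dx$$ for all measurable $f:\mathbb R^n\to[0,\infty)$; that is, $\Gamma^q(v)=\Gamma^q_1(W^{q-1}w)$ with equivalent quasi-norms. (b) If $w(\infty)=0$, then there is a weight $w_q$ such that $$\Big(\int_0^r w(x)\,dx\Big)^q\approx\int_0^r w_q(x)\,dx+r^q\int_r^\infty w_q(x)\,\frac{dx}{x^q}\qquad(r>0),$$ and for every weight $w_q$ with this property $\Lambda^1(w)\subset\Gamma^q(w_q)\subset\Gamma^{1,\infty}(w)$, with $\|f\|_{\Gamma^q(w_q)}\le C\|f\|_{\Lambda^1(w)}$ and $\|f\|_{\Gamma^{1,\infty}(w)}\le C\|f\|_{\Gamma^q(w_q)}$ for a constant $C$ independent of $f$. (c) If $w(\infty)>0$, then there is no weight $v$ for which both inclusions of sets $\Lambda^1(w)\subset\Gamma^q(v)\subset\Gamma^{1,\infty}(w)$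 hold. -/

import Mathlib

open MeasureTheory Set Filter Topology
open scoped ENNReal NNReal

noncomputable section

namespace LorentzGamma

/-- The primitive `W(t) = ∫₀ᵗ w(s) ds` of a nonnegative function on `(0, ∞)`, as an extended
nonnegative number. -/
def primitive (w : ℝ → ℝ≥0) (t : ℝ) : ℝ≥0∞ :=
  ∫⁻ s in Ioo 0 t, (w s : ℝ≥0∞)

/-- A weight: a nonnegative (Lebesgue) measurable function on `(0, ∞)`, integrable on every
bounded interval `(0, t)`. Values of `w` outside `(0, ∞)` are irrelevant. -/
structure IsWeight (w : ℝ → ℝ≥0) : Prop where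
  aemeasurable : AEMeasurable w (volume.restrict (Ioi 0))
  primitive_ne_top : ∀ t : ℝ, primitive w t ≠ ∞

variable {n : ℕ}

/-- The decreasing rearrangement `f*(t) = inf {r : |{x : f(x) > r}| ≤ t}`, with value `∞` if no
finite `r` qualifies. -/
def rearr (f : EuclideanSpace ℝ (Fin n) → ℝ≥0) (t : ℝ) : ℝ≥0∞ :=
  sInf {r : ℝ≥0∞ | volume {x | r < (f x : ℝ≥0∞)} ≤ ENNReal.ofReal t}

/-- The maximal function `f**(t) = (1/t) ∫₀ᵗ f*(s) ds`, for `t > 0`. -/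
def maxRearr (f : EuclideanSpace ℝ (Fin n) → ℝ≥0) (t : ℝ) : ℝ≥0∞ :=
  (ENNReal.ofReal t)⁻¹ * ∫⁻ s in Ioo 0 t, rearr f s

/-- The functional `‖f‖_{Λ^p(w)} = (∫₀^∞ f*(t)^p w(t) dt)^{1/p}`. -/
def lambdaNorm (p : ℝ) (w : ℝ → ℝ≥0) (f : EuclideanSpace ℝ (Fin n) → ℝ≥0) : ℝ≥0∞ :=
  (∫⁻ t in Ioi (0 : ℝ), rearr f t ^ p * (w t : ℝ≥0∞)) ^ (1 / p)

/-- The functional `‖f‖_{Γ^p(w)} = (∫₀^∞ f**(t)^p w(t) dt)^{1/p}`. -/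
def gammaNorm (p : ℝ) (w : ℝ → ℝ≥0) (f : EuclideanSpace ℝ (Fin n) → ℝ≥0) : ℝ≥0∞ :=
  (∫⁻ t in Ioi (0 : ℝ), maxRearr f t ^ p * (w t : ℝ≥0∞)) ^ (1 / p)

/-- The functional `‖f‖_{Γ^{p,∞}(w)} = sup_{t > 0} f**(t) W(t)^{1/p}`. -/
def gammaWeakNorm (p : ℝ) (w : ℝ → ℝ≥0) (f : EuclideanSpace ℝ (Fin n) → ℝ≥0) : ℝ≥0∞ :=
  ⨆ t ∈ Ioi (0 : ℝ), maxRearr f t * primitive w t ^ (1 / p)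

/-- The functional `‖f‖_{Γ^p_α(w)} = (∫₀^∞ f*(t)^α f**(t)^{p-α} w(t) dt)^{1/p}`. -/
def gammaAlphaNorm (p α : ℝ) (w : ℝ → ℝ≥0) (f : EuclideanSpace ℝ (Fin n) → ℝ≥0) : ℝ≥0∞ :=
  (∫⁻ t in Ioi (0 : ℝ), rearr f t ^ α * maxRearr f t ^ (p - α) * (w t : ℝ≥0∞)) ^ (1 / p)

/-- The space of (Lebesgue) measurable functions `f : ℝⁿ → [0, ∞)` with `N f < ∞`. -/
def space (N : (EuclideanSpace ℝ (Fin n) → ℝ≥0) → ℝ≥0∞) :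
    Set (EuclideanSpace ℝ (Fin n) → ℝ≥0) :=
  {f | AEMeasurable f volume ∧ N f < ∞}

/-- The weighted Lorentz space `Λ^p(w)` on `ℝⁿ`. -/
def Lambda (n : ℕ) (p : ℝ) (w : ℝ → ℝ≥0) : Set (EuclideanSpace ℝ (Fin n) → ℝ≥0) :=
  space (lambdaNorm p w)

/-- The space `Γ^p(w)` on `ℝⁿ`. -/
def Gamma (n : ℕ) (p : ℝ) (w : ℝ → ℝ≥0) : Set (EuclideanSpace ℝ (Fin n) → ℝ≥0) :=
  space (gammaNorm p w)

/-- The space `Γ^{p,∞}(w)` on `ℝⁿ`. -/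
def GammaWeak (n : ℕ) (p : ℝ) (w : ℝ → ℝ≥0) : Set (EuclideanSpace ℝ (Fin n) → ℝ≥0) :=
  space (gammaWeakNorm p w)

/-- The space `Γ^p_α(w)` on `ℝⁿ`. -/
def GammaAlpha (n : ℕ) (p α : ℝ) (w : ℝ → ℝ≥0) : Set (EuclideanSpace ℝ (Fin n) → ℝ≥0) :=
  space (gammaAlphaNorm p α w)

/-- `N f ≤ C * M f` for all measurable `f : ℝⁿ → [0, ∞)`, with one finite constant `C`:
the inclusion of the space of `M` into the space of `N` is bounded. -/
def BoundedBy (N M : (EuclideanSpace ℝ (Fin n) → ℝ≥0) → ℝ≥0∞) : Prop :=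
  ∃ C : ℝ≥0, ∀ f : EuclideanSpace ℝ (Fin n) → ℝ≥0, AEMeasurable f volume →
    N f ≤ (C : ℝ≥0∞) * M f

/-- The weight `t ↦ W(t)^{q-1} w(t)`. -/
def powWeight (q : ℝ) (w : ℝ → ℝ≥0) (t : ℝ) : ℝ≥0 :=
  (primitive w t).toNNReal ^ (q - 1) * w t

/-- `W(r)^q ≈ ∫₀ʳ u(x) dx + r^q ∫ᵣ^∞ u(x) x^{-q} dx`, uniformly in `r > 0`. -/
def FundamentalEquiv (q : ℝ) (w u : ℝ → ℝ≥0) : Prop :=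
  ∃ C : ℝ≥0, 0 < C ∧ ∀ r : ℝ, 0 < r →
    primitive w r ^ q ≤ (C : ℝ≥0∞) * (primitive u r + ENNReal.ofReal r ^ q *
      ∫⁻ x in Ioi r, (u x : ℝ≥0∞) / ENNReal.ofReal x ^ q) ∧
    primitive u r + ENNReal.ofReal r ^ q *
      ∫⁻ x in Ioi r, (u x : ℝ≥0∞) / ENNReal.ofReal x ^ q ≤ (C : ℝ≥0∞) * primitive w r ^ q

end LorentzGamma

end

/-! Everything is governed by the fundamental function φ(r) = ∫₀ʳ v + rᵠ ∫ᵣ^∞ v x^{-q}, the q-th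
power of the `Γ^q(v)` quasinorm of a set of measure r. For a decreasing weight w, both inclusions
together are equivalent to W^q ≈ φ.

From W^q ≈ φ to norms: for decreasing g with primitive F, the chain rule F^q = q ∫ g F^{q-1} and
Tonelli give ∫ (g**)^q v = ∫ g (g**)^{q-1} k, where k(s) = q s^{q-1} ∫ₛ^∞ v x^{-q} satisfies ∫₀ʳ k =
φ(r). Likewise W^q is the primitive of q W^{q-1} w. Since g (g**)^{q-1} is decreasing, Hardy's lemma
(`lintegral_mul_le_of_antitoneOn`) turns the comparison of primitives into the equivalence in (a).
Chebyshev's inequality g** W ≤ ∫ g w then gives the bound by Λ¹(w), and monotonicity of g** and of x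
g**(x) gives the bound of the weak norm.

From set inclusions to W^q ≈ φ: no closed graph theorem is available for these sets of nonnegative
functions, so a gliding hump (`exists_bound_of_finite_imp`) sums normalised characteristic functions
that violate every bound. The sum is decreasing, hence a rearrangement by `exists_rearr_ae_eq`, and
contradicts the inclusion.

Existence in (b): with h = (W/x)^{q-1} w, the weight x^{q-1}(h(x) - h(2x)) makes the tail integral
in k of Frullani type, hence comparable with h when h tends to 0. For (c), φ(r)/rᵠ tends to 0
whenever φ(1) is finite, whereas W(r) ≥ cr if w has limit c > 0. -/

namespace LorentzGamma

/-! ### Layer cake formula, Hardy's lemma and Tonelli on a triangle. -/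

/-- Layer cake formula for extended nonnegative functions. -/
theorem lintegral_eq_lintegral_superlevel (μ : Measure ℝ) [SFinite μ] {h : ℝ → ℝ≥0∞}
    (hh : Measurable h) :
    ∫⁻ x, h x ∂μ = ∫⁻ t in Ioi (0 : ℝ), μ {x | ENNReal.ofReal t < h x} := by
  have key : ∀ y : ℝ≥0∞, y = ∫⁻ t in Ioi (0 : ℝ),
      {t : ℝ | ENNReal.ofReal t < y}.indicator 1 t := by
    intro y
    rw [lintegral_indicator_one (measurableSet_lt ENNReal.measurable_ofReal measurable_const),
      Measure.restrict_apply (measurableSet_lt ENNReal.measurable_ofReal measurable_const)]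
    rcases eq_or_ne y ∞ with rfl | hy
    · simp
    · have : {t : ℝ | ENNReal.ofReal t < y} ∩ Ioi 0 = Ioo 0 y.toReal := by
        ext t
        simp only [mem_inter_iff, mem_ofPred_eq, mem_Ioi, mem_Ioo]
        constructor
        · rintro ⟨h1, h2⟩
          exact ⟨h2, (ENNReal.ofReal_lt_iff_lt_toReal h2.le hy).1 h1⟩
        · rintro ⟨h1, h2⟩
          exact ⟨(ENNReal.ofReal_lt_iff_lt_toReal h1.le hy).2 h2, h1⟩
      rw [this]
      simp [hy]
  have hm : MeasurableSet {p : ℝ × ℝ | ENNReal.ofReal p.2 < h p.1} :=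
    measurableSet_lt (ENNReal.measurable_ofReal.comp measurable_snd) (hh.comp measurable_fst)
  calc ∫⁻ x, h x ∂μ = ∫⁻ x, (∫⁻ t in Ioi (0 : ℝ),
        {p : ℝ × ℝ | ENNReal.ofReal p.2 < h p.1}.indicator 1 (x, t)) ∂μ :=
        lintegral_congr fun x => key (h x)
    _ = ∫⁻ t in Ioi (0 : ℝ), ∫⁻ x,
        {p : ℝ × ℝ | ENNReal.ofReal p.2 < h p.1}.indicator 1 (x, t) ∂μ :=
        lintegral_lintegral_swap (f := fun x t =>
          {p : ℝ × ℝ | ENNReal.ofReal p.2 < h p.1}.indicator 1 (x, t))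
          (measurable_one.indicator hm).aemeasurable
    _ = _ := by
        refine lintegral_congr fun t => ?_
        rw [← lintegral_indicator_one (measurableSet_lt measurable_const hh)]
        rfl

theorem setLIntegral_Ioi_eq_iSup (k : ℝ → ℝ≥0∞) :
    ∫⁻ x in Ioi 0, k x = ⨆ m : ℕ, ∫⁻ x in Ioo 0 ((m : ℝ) + 1), k x := by
  have : Ioi (0 : ℝ) = ⋃ m : ℕ, Ioo 0 ((m : ℝ) + 1) := by
    ext x
    simp only [mem_Ioi, mem_iUnion, mem_Ioo]
    refine ⟨fun hx => ?_, fun ⟨_, h, _⟩ => h⟩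
    obtain ⟨m, hm⟩ := exists_nat_gt x
    exact ⟨m, hx, by linarith⟩
  rw [this, setLIntegral_iUnion_of_directed]
  refine directed_of_isDirected_le fun a b hab => Ioo_subset_Ioo_right ?_
  have : (a : ℝ) ≤ b := by exact_mod_cast hab
  linarith

/-- Hardy's lemma: averages of the kernels over initial intervals control integrals against
decreasing functions. -/
theorem lintegral_mul_le_of_antitoneOn {h k₁ k₂ : ℝ → ℝ≥0∞} (hh : AntitoneOn h (Ioi 0))
    (hk₁ : AEMeasurable k₁ (volume.restrict (Ioi 0)))
    (hk₂ : AEMeasurable k₂ (volume.restrict (Ioi 0)))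
    (H : ∀ r : ℝ, 0 < r → ∫⁻ x in Ioo 0 r, k₁ x ≤ ∫⁻ x in Ioo 0 r, k₂ x) :
    ∫⁻ x in Ioi 0, h x * k₁ x ≤ ∫⁻ x in Ioi 0, h x * k₂ x := by
  -- The value ∞ on (-∞, 0] makes the function decreasing on the whole line, so that each superlevel
  -- set is closed downwards and contains 0. Its trace on (0, ∞) is then, up to a null set, an
  -- initial interval or the whole half-line.
  set h' : ℝ → ℝ≥0∞ := fun x => if x ≤ 0 then ∞ else h x with hh'
  have hanti : Antitone h' := by
    intro a b hab
    simp only [hh']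
    split_ifs with h1 h2 h2
    · exact le_rfl
    · linarith
    · exact le_top
    · exact hh (not_le.1 h2) (not_le.1 h1) hab
  have key : ∀ k : ℝ → ℝ≥0∞, AEMeasurable k (volume.restrict (Ioi 0)) →
      ∫⁻ x in Ioi 0, h x * k x = ∫⁻ t in Ioi (0 : ℝ),
        ((volume.restrict (Ioi 0)).withDensity k) {x | ENNReal.ofReal t < h' x} := by
    intro k hk
    rw [← lintegral_eq_lintegral_superlevel _ hanti.measurable,
      lintegral_withDensity_eq_lintegral_mul₀ hk hanti.measurable.aemeasurable]
    refine setLIntegral_congr_fun measurableSet_Ioi fun x hx => ?_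
    have : ¬ x ≤ 0 := not_le.2 hx
    simp [hh', this, mul_comm]
  rw [key _ hk₁, key _ hk₂]
  refine lintegral_mono fun t => ?_
  have hms : MeasurableSet {x | ENNReal.ofReal t < h' x} :=
    measurableSet_lt measurable_const hanti.measurable
  rw [withDensity_apply _ hms, withDensity_apply _ hms, Measure.restrict_restrict hms]
  set S := {x | ENNReal.ofReal t < h' x}
  have hS : ∀ x ∈ S, ∀ y ≤ x, y ∈ S := fun x hx y hy => lt_of_lt_of_le hx (hanti hy)
  by_cases hb : BddAbove S
  · have h0S : (0 : ℝ) ∈ S := by simp [S, hh']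
    have hae : (S ∩ Ioi 0 : Set ℝ) =ᵐ[volume] Ioo 0 (sSup S) := by
      have h1 : Ioo 0 (sSup S) ⊆ S ∩ Ioi 0 := by
        rintro x ⟨hx0, hx1⟩
        obtain ⟨y, hy, hxy⟩ := exists_lt_of_lt_csSup ⟨0, h0S⟩ hx1
        exact ⟨hS y hy x hxy.le, hx0⟩
      have h2 : S ∩ Ioi 0 ⊆ Ioc 0 (sSup S) := fun x hx => ⟨hx.2, le_csSup hb hx.1⟩
      refine (LE.le.eventuallyLE h2).antisymm ?_ |>.trans ?_
      · exact (Ioo_ae_eq_Ioc (μ := volume)).symm.le.trans (LE.le.eventuallyLE h1)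
      · exact (Ioo_ae_eq_Ioc (μ := volume)).symm
    rw [setLIntegral_congr hae, setLIntegral_congr hae]
    rcases (le_csSup hb h0S).eq_or_lt with h0 | h0
    · simp [← h0]
    · exact H _ h0
  · have hu : S ∩ Ioi 0 = Ioi 0 := by
      refine inter_eq_right.2 fun x _ => ?_
      obtain ⟨y, hy, hxy⟩ := not_bddAbove_iff.1 hb x
      exact hS y hy x hxy.le
    rw [hu, setLIntegral_Ioi_eq_iSup, setLIntegral_Ioi_eq_iSup]
    exact iSup_mono fun m => H _ (by positivity)

/-- Tonelli's theorem on the region `0 < s < x`. -/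
theorem lintegral_mul_lintegral_Ioo {a b : ℝ → ℝ≥0∞}
    (ha : AEMeasurable a (volume.restrict (Ioi 0)))
    (hb : AEMeasurable b (volume.restrict (Ioi 0))) :
    ∫⁻ x in Ioi 0, a x * ∫⁻ s in Ioo 0 x, b s = ∫⁻ s in Ioi 0, b s * ∫⁻ x in Ioi s, a x := by
  have hm : MeasurableSet {p : ℝ × ℝ | p.2 < p.1} := measurableSet_lt measurable_snd measurable_fst
  have h1 : ∀ x ∈ Ioi (0 : ℝ), a x * ∫⁻ s in Ioo 0 x, b s =
      ∫⁻ s in Ioi 0, {p : ℝ × ℝ | p.2 < p.1}.indicator 1 (x, s) * (a x * b s) := by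
    intro x hx
    have : Ioo 0 x = Iio x ∩ Ioi 0 := by ext; simp [and_comm]
    rw [this, ← Measure.restrict_restrict measurableSet_Iio, ← lintegral_indicator measurableSet_Iio,
      ← lintegral_const_mul'' _ (hb.indicator measurableSet_Iio)]
    refine lintegral_congr fun s => ?_
    by_cases hs : s < x <;> simp [indicator, hs]
  have h2 : ∀ s ∈ Ioi (0 : ℝ), b s * ∫⁻ x in Ioi s, a x =
      ∫⁻ x in Ioi 0, {p : ℝ × ℝ | p.2 < p.1}.indicator 1 (x, s) * (a x * b s) := by
    intro s hs
    have : Ioi s = Ioi s ∩ Ioi 0 := by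
      rw [Ioi_inter_Ioi, max_eq_left (le_of_lt hs)]
    rw [this, ← Measure.restrict_restrict measurableSet_Ioi, ← lintegral_indicator measurableSet_Ioi,
      ← lintegral_const_mul'' _ (ha.indicator measurableSet_Ioi)]
    refine lintegral_congr fun x => ?_
    by_cases hs : s < x <;> simp [indicator, hs, mul_comm]
  rw [setLIntegral_congr_fun measurableSet_Ioi h1, setLIntegral_congr_fun measurableSet_Ioi h2]
  refine lintegral_lintegral_swap ?_
  refine ((measurable_one.indicator hm).aemeasurable).mul (ha.comp_fst.mul hb.comp_snd)

/-! ### Primitives and averages of decreasing functions. -/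

/-- A decreasing function that is finite at s is bounded to the right of s, so divergence can only
come from the origin. -/
theorem setLIntegral_Ioo_eq_top_of_antitoneOn {g : ℝ → ℝ≥0∞} (hg : AntitoneOn g (Ioi 0)) {x s : ℝ}
    (hs : 0 < s) (h : ∫⁻ u in Ioo 0 x, g u = ∞) : ∫⁻ u in Ioo 0 s, g u = ∞ := by
  by_contra hne
  have hfin : g s ≠ ∞ := by
    intro hgs
    refine hne (top_le_iff.1 ?_)
    calc (∞ : ℝ≥0∞) = ∫⁻ u in Ioo 0 s, ∞ := by simp [hs]
      _ ≤ _ := setLIntegral_mono' measurableSet_Ioo fun u hu => by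
        rw [← hgs]; exact hg hu.1 hs hu.2.le
  have h1 : Ioo 0 x ⊆ Ioo 0 s ∪ Ico s x := by
    intro u hu
    rcases lt_or_ge u s with h | h
    · exact Or.inl ⟨hu.1, h⟩
    · exact Or.inr ⟨h, hu.2⟩
  have h2 : ∫⁻ u in Ico s x, g u ≤ g s * ENNReal.ofReal (x - s) := by
    calc _ ≤ ∫⁻ u in Ico s x, g s := setLIntegral_mono' measurableSet_Ico fun u hu =>
          hg hs (lt_of_lt_of_le hs hu.1) hu.1
      _ = _ := by simp
  have h3 := (lintegral_mono_set (μ := volume) (f := g) h1).trans (lintegral_union_le _ _ _)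
  rw [h, top_le_iff, ENNReal.add_eq_top] at h3
  rcases h3 with h3 | h3
  · exact hne h3
  · rw [h3, top_le_iff] at h2
    exact ENNReal.mul_ne_top hfin ENNReal.ofReal_ne_top h2

/-- The chain rule `F(x)^q = q ∫₀ˣ g F^{q-1}` for the primitive `F` of a decreasing function. -/
theorem lintegral_Ioo_rpow {g : ℝ → ℝ≥0∞} (hg : AntitoneOn g (Ioi 0)) {q : ℝ} (hq : 1 < q) (x : ℝ) :
    (∫⁻ s in Ioo 0 x, g s) ^ q =
      ENNReal.ofReal q * ∫⁻ s in Ioo 0 x, g s * (∫⁻ u in Ioo 0 s, g u) ^ (q - 1) := by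
  rcases le_or_gt x 0 with hx | hx
  · simp [Ioo_eq_empty (not_lt.2 hx), show 0 < q by linarith]
  by_cases hF : ∫⁻ s in Ioo 0 x, g s = ∞
  -- If F(x) is infinite, so is F(s) for every s > 0, and both sides are infinite. Otherwise g is
  -- finite on (0, ∞) and the calculus is done in the reals.
  · have : ∫⁻ s in Ioo 0 x, g s * (∫⁻ u in Ioo 0 s, g u) ^ (q - 1) = ∞ := by
      refine top_le_iff.1 ?_
      calc (∞ : ℝ≥0∞) = ∞ * ∫⁻ s in Ioo 0 x, g s := by rw [hF]; simp
        _ ≤ ∫⁻ s in Ioo 0 x, ∞ * g s := lintegral_const_mul_le _ _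
        _ = _ := setLIntegral_congr_fun measurableSet_Ioo fun s hs => by
          rw [setLIntegral_Ioo_eq_top_of_antitoneOn hg hs.1 hF, ENNReal.top_rpow_of_pos (by linarith),
            mul_comm]
    rw [this, hF, ENNReal.top_rpow_of_pos (by linarith), ENNReal.mul_top]
    simpa using by linarith
  have hfin : ∀ s ∈ Ioi (0 : ℝ), g s ≠ ∞ := by
    intro s hs hgs
    refine hF (setLIntegral_Ioo_eq_top_of_antitoneOn hg (x := s) hx (top_le_iff.1 ?_))
    calc (∞ : ℝ≥0∞) = ∫⁻ u in Ioo 0 s, ∞ := by simp [mem_Ioi.1 hs]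
      _ ≤ _ := setLIntegral_mono' measurableSet_Ioo fun u hu => by
        rw [← hgs]; exact hg hu.1 hs hu.2.le
  set γ : ℝ → ℝ := fun s => (g s).toReal with hγ
  have hγanti : AntitoneOn γ (Ioi 0) := fun a ha b hb hab =>
    ENNReal.toReal_mono (hfin a ha) (hg ha hb hab)
  have hsub : Ioo 0 x ⊆ Ioi 0 := fun s hs => hs.1
  have hgm : AEMeasurable g (volume.restrict (Ioo 0 x)) :=
    (aemeasurable_restrict_of_antitoneOn measurableSet_Ioi hg).mono_set hsub
  have hint : IntegrableOn γ (Ioc 0 x) := by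
    rw [integrableOn_Ioc_iff_integrableOn_Ioo]
    exact integrable_toReal_of_lintegral_ne_top hgm hF
  have hii : ∀ s ∈ Icc 0 x, IntervalIntegrable γ volume 0 s := fun s hs => by
    rw [intervalIntegrable_iff_integrableOn_Ioc_of_le hs.1]
    exact hint.mono_set (Ioc_subset_Ioc_right hs.2)
  set G : ℝ → ℝ := fun s => ∫ u in (0 : ℝ)..s, γ u with hG
  have hG0 : ∀ s, 0 ≤ s → 0 ≤ G s := fun s hs =>
    intervalIntegral.integral_nonneg hs fun u _ => ENNReal.toReal_nonneg
  have hGeq : ∀ s ∈ Icc 0 x, ENNReal.ofReal (G s) = ∫⁻ u in Ioo 0 s, g u := by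
    intro s hs
    rw [hG]
    simp only []
    rw [intervalIntegral.integral_of_le hs.1, ofReal_integral_eq_lintegral_ofReal
      (hint.mono_set (Ioc_subset_Ioc_right hs.2)) (ae_of_all _ fun u => ENNReal.toReal_nonneg),
      setLIntegral_congr Ioo_ae_eq_Ioc.symm]
    exact setLIntegral_congr_fun measurableSet_Ioo fun u hu => ENNReal.ofReal_toReal (hfin u hu.1)
  have hcont : ContinuousOn G (uIcc 0 x) := by
    refine intervalIntegral.continuousOn_primitive_interval ?_
    rw [uIcc_of_le hx.le, integrableOn_Icc_iff_integrableOn_Ioc]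
    exact hint
  -- A monotone function has countably many discontinuities; off them G is differentiable, and the
  -- fundamental theorem of calculus tolerates a countable exceptional set.
  set N := {s | s ∈ Ioi (0 : ℝ) ∧ ¬ ContinuousWithinAt γ (Ioi 0) s}
  have hN : N.Countable := hγanti.countable_not_continuousWithinAt
  have hderiv : ∀ s ∈ Ioo (min 0 x) (max 0 x) \ N,
      HasDerivAt (fun s => G s ^ q) (γ s * q * G s ^ (q - 1)) s := by
    rintro s ⟨hs, hsN⟩
    rw [min_eq_left hx.le, max_eq_right hx.le] at hs
    have hc : ContinuousAt γ s := by
      by_contra hc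
      exact hsN ⟨hs.1, fun h => hc (h.continuousAt (Ioi_mem_nhds hs.1))⟩
    have hd : HasDerivAt G (γ s) s := by
      refine intervalIntegral.integral_hasDerivAt_right (hii s ⟨hs.1.le, hs.2.le⟩) ?_ hc
      exact ⟨Ioi 0, Ioi_mem_nhds hs.1,
        (aemeasurable_restrict_of_antitoneOn measurableSet_Ioi hγanti).aestronglyMeasurable⟩
    exact hd.rpow_const (Or.inr hq.le)
  have hcont' : ContinuousOn (fun s => G s ^ (q - 1)) (uIcc 0 x) :=
    hcont.rpow_const fun s _ => Or.inr (by linarith)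
  have hi : IntervalIntegrable (fun s => γ s * q * G s ^ (q - 1)) volume 0 x :=
    ((hii x ⟨hx.le, le_rfl⟩).mul_const q).mul_continuousOn hcont'
  have hftc := integral_eq_of_hasDerivAt_off_countable (fun s => G s ^ q)
    (fun s => γ s * q * G s ^ (q - 1)) hN (hcont.rpow_const fun s _ => Or.inr (by linarith))
    hderiv hi
  have hGz : G 0 ^ q = 0 := by
    simp only [hG, intervalIntegral.integral_same]
    exact Real.zero_rpow (by linarith)
  rw [hGz, sub_zero] at hftc
  rw [← hGeq x ⟨hx.le, le_rfl⟩, ENNReal.ofReal_rpow_of_nonneg (hG0 x hx.le) (by linarith), ← hftc,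
    intervalIntegral.integral_of_le hx.le, ofReal_integral_eq_lintegral_ofReal,
    setLIntegral_congr Ioo_ae_eq_Ioc.symm, ← lintegral_const_mul']
  · refine setLIntegral_congr_fun measurableSet_Ioo fun s hs => ?_
    rw [← hGeq s ⟨hs.1.le, hs.2.le⟩, ENNReal.ofReal_rpow_of_nonneg (hG0 s hs.1.le) (by linarith),
      ENNReal.ofReal_mul (mul_nonneg ENNReal.toReal_nonneg (by linarith)),
      ENNReal.ofReal_mul ENNReal.toReal_nonneg, ENNReal.ofReal_toReal (hfin s hs.1)]
    ring
  · exact ENNReal.ofReal_ne_top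
  · exact (intervalIntegrable_iff_integrableOn_Ioc_of_le hx.le).1 hi
  · refine (ae_restrict_iff' measurableSet_Ioc).2 (ae_of_all _ fun s hs => ?_)
    exact mul_nonneg (mul_nonneg ENNReal.toReal_nonneg (by linarith))
      (Real.rpow_nonneg (hG0 s hs.1.le) _)

/-- The average of `g` over `(0, t)`. -/
noncomputable def initialAverage (g : ℝ → ℝ≥0∞) (t : ℝ) : ℝ≥0∞ :=
  (ENNReal.ofReal t)⁻¹ * ∫⁻ s in Ioo 0 t, g s

theorem maxRearr_eq {n : ℕ} (f : EuclideanSpace ℝ (Fin n) → ℝ≥0) :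
    maxRearr f = initialAverage (rearr f) := rfl

theorem ofReal_mul_initialAverage (g : ℝ → ℝ≥0∞) (t : ℝ) :
    ENNReal.ofReal t * initialAverage g t = ∫⁻ s in Ioo 0 t, g s := by
  rcases le_or_gt t 0 with ht | ht
  · simp [ENNReal.ofReal_of_nonpos ht, Ioo_eq_empty (not_lt.2 ht)]
  · rw [initialAverage, ← mul_assoc, ENNReal.mul_inv_cancel (by simpa using ht)
      ENNReal.ofReal_ne_top, one_mul]

theorem initialAverage_mono {g₁ g₂ : ℝ → ℝ≥0∞} (h : g₁ ≤ g₂) (t : ℝ) :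
    initialAverage g₁ t ≤ initialAverage g₂ t :=
  mul_le_mul_right (lintegral_mono h) _

theorem initialAverage_congr {g₁ g₂ : ℝ → ℝ≥0∞} (h : g₁ =ᵐ[volume.restrict (Ioi 0)] g₂) :
    initialAverage g₁ = initialAverage g₂ := by
  ext t
  rw [initialAverage, initialAverage]
  congr 1
  exact lintegral_congr_ae (ae_restrict_of_ae_restrict_of_subset (fun x hx => hx.1) h)

theorem mul_le_lintegral_Ioo {g : ℝ → ℝ≥0∞} (hg : AntitoneOn g (Ioi 0)) {t : ℝ} (ht : 0 < t) :
    g t * ENNReal.ofReal t ≤ ∫⁻ s in Ioo 0 t, g s :=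
  calc g t * ENNReal.ofReal t = ∫⁻ _ in Ioo 0 t, g t := by simp
    _ ≤ _ := setLIntegral_mono' measurableSet_Ioo fun _ hs => hg hs.1 ht hs.2.le

/-- Beyond s the values are at most g(s), which is itself at most the average over (0, s); enlarging
the interval therefore cannot raise the average. -/
theorem initialAverage_antitoneOn {g : ℝ → ℝ≥0∞} (hg : AntitoneOn g (Ioi 0)) :
    AntitoneOn (initialAverage g) (Ioi 0) := by
  intro s hs t ht hst
  have hs' : 0 < s := hs
  have ht' : 0 < t := ht
  have h1 : ∫⁻ u in Ioo 0 t, g u ≤ (∫⁻ u in Ioo 0 s, g u) + g s * ENNReal.ofReal (t - s) := by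
    have hsub : Ioo 0 t ⊆ Ioo 0 s ∪ Ico s t := by
      intro u hu
      rcases lt_or_ge u s with h | h
      · exact Or.inl ⟨hu.1, h⟩
      · exact Or.inr ⟨h, hu.2⟩
    refine ((lintegral_mono_set hsub).trans (lintegral_union_le _ _ _)).trans ?_
    gcongr
    calc _ ≤ ∫⁻ u in Ico s t, g s := setLIntegral_mono' measurableSet_Ico fun u hu =>
          hg hs (lt_of_lt_of_le hs hu.1) hu.1
      _ = _ := by simp
  have h2 := mul_le_lintegral_Ioo hg hs'
  rw [initialAverage, initialAverage, mul_comm, ← div_eq_mul_inv,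
    ENNReal.div_le_iff (by simpa using ht') (by simp), mul_comm, ← mul_assoc, mul_comm _ (_⁻¹),
    mul_assoc, ← ENNReal.div_eq_inv_mul,
    ENNReal.le_div_iff_mul_le (by simp [hs']) (by simp)]
  calc _ ≤ ((∫⁻ u in Ioo 0 s, g u) + g s * ENNReal.ofReal (t - s)) * ENNReal.ofReal s := by gcongr
    _ = (∫⁻ u in Ioo 0 s, g u) * ENNReal.ofReal s +
        (g s * ENNReal.ofReal s) * ENNReal.ofReal (t - s) := by ring
    _ ≤ (∫⁻ u in Ioo 0 s, g u) * ENNReal.ofReal s +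
        (∫⁻ u in Ioo 0 s, g u) * ENNReal.ofReal (t - s) := by gcongr
    _ = _ := by
      rw [← mul_add, ← ENNReal.ofReal_add hs'.le (by linarith [show s ≤ t from hst]), mul_comm]
      ring_nf

/-! ### The fundamental function and its density. -/

/-- `∫₀ʳ u + rᵠ ∫ᵣ^∞ u x^{-q}`, the `q`-th power of the `Γ^q(u)` quasinorm of a set of
measure `r`. -/
noncomputable def fundamentalFn (q : ℝ) (u : ℝ → ℝ≥0) (r : ℝ) : ℝ≥0∞ :=
  primitive u r + ENNReal.ofReal r ^ q * ∫⁻ x in Ioi r, (u x : ℝ≥0∞) / ENNReal.ofReal x ^ q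

theorem aemeasurable_coe {u : ℝ → ℝ≥0} (hu : AEMeasurable u (volume.restrict (Ioi 0))) :
    AEMeasurable (fun x => (u x : ℝ≥0∞)) (volume.restrict (Ioi 0)) :=
  measurable_coe_nnreal_ennreal.comp_aemeasurable hu

theorem aemeasurable_div {u : ℝ → ℝ≥0} (hu : AEMeasurable u (volume.restrict (Ioi 0))) (q : ℝ) :
    AEMeasurable (fun x => (u x : ℝ≥0∞) / ENNReal.ofReal x ^ q) (volume.restrict (Ioi 0)) :=
  (aemeasurable_coe hu).div (ENNReal.measurable_ofReal.pow_const q).aemeasurable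

/-- The key identity: the chain rule for the q-th power of the primitive, followed by Tonelli. It
linearises the Γ^q functional as an integral of the decreasing function g (g**)^{q-1} against a
kernel that depends on u alone, which is the form Hardy's lemma needs. -/
theorem lintegral_initialAverage_rpow {g : ℝ → ℝ≥0∞} (hg : AntitoneOn g (Ioi 0)) {q : ℝ}
    (hq : 1 < q) {u : ℝ → ℝ≥0} (hu : AEMeasurable u (volume.restrict (Ioi 0))) :
    ∫⁻ x in Ioi 0, initialAverage g x ^ q * u x =
      ∫⁻ s in Ioi 0, (g s * initialAverage g s ^ (q - 1)) *
        (ENNReal.ofReal q * ENNReal.ofReal s ^ (q - 1) *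
          ∫⁻ x in Ioi s, (u x : ℝ≥0∞) / ENNReal.ofReal x ^ q) := by
  have hgm : AEMeasurable g (volume.restrict (Ioi 0)) :=
    aemeasurable_restrict_of_antitoneOn measurableSet_Ioi hg
  have hFm : Monotone fun s => ∫⁻ u in Ioo 0 s, g u := fun a b hab =>
    lintegral_mono_set (Ioo_subset_Ioo_right hab)
  set b : ℝ → ℝ≥0∞ := fun s => ENNReal.ofReal q * (g s * (∫⁻ u in Ioo 0 s, g u) ^ (q - 1))
  have hb : AEMeasurable b (volume.restrict (Ioi 0)) :=
    (hgm.mul (hFm.measurable.pow_const _).aemeasurable).const_mul _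
  calc _ = ∫⁻ x in Ioi 0, ((u x : ℝ≥0∞) / ENNReal.ofReal x ^ q) * ∫⁻ s in Ioo 0 x, b s := by
        refine setLIntegral_congr_fun measurableSet_Ioi fun x hx => ?_
        have hx0 : ENNReal.ofReal x ≠ 0 := by simpa using hx
        simp only [b]
        rw [lintegral_const_mul' _ _ ENNReal.ofReal_ne_top, ← lintegral_Ioo_rpow hg hq,
          initialAverage, ENNReal.mul_rpow_of_nonneg _ _ (by linarith), ENNReal.inv_rpow,
          div_eq_mul_inv]
        ring
    _ = _ := by
        rw [lintegral_mul_lintegral_Ioo (aemeasurable_div hu q) hb]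
        refine setLIntegral_congr_fun measurableSet_Ioi fun s hs => ?_
        simp only [b]
        rw [← ofReal_mul_initialAverage, ENNReal.mul_rpow_of_nonneg _ _ (by linarith)]
        ring

/-- The decreasing rearrangement of the characteristic function of a set of measure `r`. -/
noncomputable def initialIndicator (r : ℝ) : ℝ → ℝ≥0∞ := (Iio r).indicator 1

theorem antitone_initialIndicator (r : ℝ) : Antitone (initialIndicator r) := by
  intro a b hab
  by_cases hb : b < r
  · simp [initialIndicator, hb, lt_of_le_of_lt hab hb]
  · simp [initialIndicator, hb]

theorem lintegral_initialIndicator (r x : ℝ) :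
    ∫⁻ s in Ioo 0 x, initialIndicator r s = ENNReal.ofReal (min x r) := by
  rw [initialIndicator, lintegral_indicator_one measurableSet_Iio,
    Measure.restrict_apply measurableSet_Iio, inter_comm, Ioo_inter_Iio, Real.volume_Ioo, sub_zero]

theorem initialAverage_initialIndicator_of_le {r x : ℝ} (hx : 0 < x) (hxr : x ≤ r) :
    initialAverage (initialIndicator r) x = 1 := by
  rw [initialAverage, lintegral_initialIndicator, min_eq_left hxr,
    ENNReal.inv_mul_cancel (by simpa using hx) (by simp)]

theorem lintegral_initialAverage_initialIndicator {q : ℝ} (hq : 1 < q) {u : ℝ → ℝ≥0}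
    {r : ℝ} (hr : 0 < r) :
    ∫⁻ x in Ioi 0, initialAverage (initialIndicator r) x ^ q * u x = fundamentalFn q u r := by
  rw [← Ioc_union_Ioi_eq_Ioi hr.le, lintegral_union measurableSet_Ioi (by
    rw [Set.disjoint_left]; intro x hx hx'; exact absurd hx.2 (not_le.2 hx')), fundamentalFn,
    primitive]
  congr 1
  · rw [setLIntegral_congr Ioo_ae_eq_Ioc]
    refine setLIntegral_congr_fun measurableSet_Ioc fun x hx => ?_
    rw [initialAverage_initialIndicator_of_le hx.1 hx.2]
    simp
  · rw [← lintegral_const_mul' _ _ (ENNReal.rpow_ne_top_of_nonneg (by linarith) (by simp))]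
    refine setLIntegral_congr_fun measurableSet_Ioi fun x hx => ?_
    rw [initialAverage, lintegral_initialIndicator, min_eq_right (le_of_lt hx),
      ENNReal.mul_rpow_of_nonneg _ _ (by linarith), ENNReal.inv_rpow, div_eq_mul_inv]
    ring

/-- This is the key identity for the indicator of the initial interval, for which g (g**)^{q-1} is
again that indicator. -/
theorem lintegral_kernel {q : ℝ} (hq : 1 < q) {u : ℝ → ℝ≥0}
    (hu : AEMeasurable u (volume.restrict (Ioi 0))) {r : ℝ} (hr : 0 < r) :
    ∫⁻ s in Ioo 0 r, ENNReal.ofReal q * ENNReal.ofReal s ^ (q - 1) *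
      ∫⁻ x in Ioi s, (u x : ℝ≥0∞) / ENNReal.ofReal x ^ q = fundamentalFn q u r := by
  rw [← lintegral_initialAverage_initialIndicator hq hr,
    lintegral_initialAverage_rpow ((antitone_initialIndicator r).antitoneOn _) hq hu]
  have : Ioo 0 r = Iio r ∩ Ioi 0 := by ext; simp [and_comm]
  rw [this, ← Measure.restrict_restrict measurableSet_Iio, ← lintegral_indicator measurableSet_Iio]
  refine setLIntegral_congr_fun measurableSet_Ioi fun x hx => ?_
  by_cases hxr : x < r
  · simp only [indicator, mem_Iio, hxr, if_true]
    rw [initialAverage_initialIndicator_of_le hx hxr.le]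
    simp [initialIndicator, hxr]
  · simp [initialIndicator, indicator, hxr]

theorem measurable_kernel (q : ℝ) (u : ℝ → ℝ≥0) : Measurable fun s =>
    ENNReal.ofReal q * ENNReal.ofReal s ^ (q - 1) *
      ∫⁻ x in Ioi s, (u x : ℝ≥0∞) / ENNReal.ofReal x ^ q := by
  have : Antitone fun s => ∫⁻ x in Ioi s, (u x : ℝ≥0∞) / ENNReal.ofReal x ^ q :=
    fun a b hab => lintegral_mono_set (Ioi_subset_Ioi hab)
  exact ((ENNReal.measurable_ofReal.pow_const _).const_mul _).mul this.measurable

theorem monotone_primitive (w : ℝ → ℝ≥0) : Monotone (primitive w) := fun _ _ hab =>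
  lintegral_mono_set (Ioo_subset_Ioo_right hab)

theorem antitoneOn_coe {w : ℝ → ℝ≥0} (hw : AntitoneOn w (Ioi 0)) :
    AntitoneOn (fun x => (w x : ℝ≥0∞)) (Ioi 0) := fun _ ha _ hb hab =>
  ENNReal.coe_le_coe.2 (hw ha hb hab)

theorem primitive_rpow {w : ℝ → ℝ≥0} (hw : AntitoneOn w (Ioi 0)) {q : ℝ} (hq : 1 < q) (r : ℝ) :
    primitive w r ^ q =
      ∫⁻ s in Ioo 0 r, ENNReal.ofReal q * (primitive w s ^ (q - 1) * w s) := by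
  rw [lintegral_const_mul' _ _ ENNReal.ofReal_ne_top, primitive,
    lintegral_Ioo_rpow (antitoneOn_coe hw) hq]
  congr 1
  exact lintegral_congr fun s => mul_comm _ _

theorem antitoneOn_mul_initialAverage_rpow {g : ℝ → ℝ≥0∞} (hg : AntitoneOn g (Ioi 0)) {q : ℝ}
    (hq : 1 < q) : AntitoneOn (fun s => g s * initialAverage g s ^ (q - 1)) (Ioi 0) :=
  fun _ ha _ hb hab => mul_le_mul' (hg ha hb hab)
    (ENNReal.rpow_le_rpow (initialAverage_antitoneOn hg ha hb hab) (by linarith))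

/-! ### Inequalities for a single decreasing function. -/

section Core

variable {g : ℝ → ℝ≥0∞} {q : ℝ} {w u : ℝ → ℝ≥0} {C : ℝ≥0∞}

theorem aemeasurable_primitive_rpow_mul (hw : AntitoneOn w (Ioi 0)) :
    AEMeasurable (fun s => ENNReal.ofReal q * (primitive w s ^ (q - 1) * w s))
      (volume.restrict (Ioi 0)) :=
  ((((monotone_primitive w).measurable.pow_const _).aemeasurable).mul
    (aemeasurable_restrict_of_antitoneOn measurableSet_Ioi (antitoneOn_coe hw))).const_mul _

/-- Hardy's lemma compares the kernel with C q W^{q-1} w, whose primitive is C W^q; hence the extra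
factor q. -/
theorem lintegral_gamma_le (hg : AntitoneOn g (Ioi 0)) (hq : 1 < q) (hw : AntitoneOn w (Ioi 0))
    (hu : AEMeasurable u (volume.restrict (Ioi 0))) (hC : C ≠ ∞)
    (H : ∀ r : ℝ, 0 < r → fundamentalFn q u r ≤ C * primitive w r ^ q) :
    ∫⁻ x in Ioi 0, initialAverage g x ^ q * u x ≤ C * ENNReal.ofReal q *
      ∫⁻ x in Ioi 0, g x * initialAverage g x ^ (q - 1) * primitive w x ^ (q - 1) * w x := by
  rw [lintegral_initialAverage_rpow hg hq hu, ← lintegral_const_mul' _ _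
    (ENNReal.mul_ne_top hC ENNReal.ofReal_ne_top)]
  refine (lintegral_mul_le_of_antitoneOn (antitoneOn_mul_initialAverage_rpow hg hq)
    (measurable_kernel q u).aemeasurable
    ((aemeasurable_primitive_rpow_mul (q := q) hw).const_mul C) fun r hr => ?_).trans_eq ?_
  · rw [lintegral_kernel hq hu hr, lintegral_const_mul' _ _ hC, ← primitive_rpow hw hq]
    exact H r hr
  · refine lintegral_congr fun x => ?_
    ring

/-- Hardy's lemma in the opposite direction. Here the factor q sits on the smaller side and is
discarded, since q > 1. -/
theorem le_lintegral_gamma (hg : AntitoneOn g (Ioi 0)) (hq : 1 < q) (hw : AntitoneOn w (Ioi 0))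
    (hu : AEMeasurable u (volume.restrict (Ioi 0))) (hC : C ≠ ∞)
    (H : ∀ r : ℝ, 0 < r → primitive w r ^ q ≤ C * fundamentalFn q u r) :
    ∫⁻ x in Ioi 0, g x * initialAverage g x ^ (q - 1) * primitive w x ^ (q - 1) * w x ≤
      C * ∫⁻ x in Ioi 0, initialAverage g x ^ q * u x := by
  rw [lintegral_initialAverage_rpow hg hq hu, ← lintegral_const_mul' _ _ hC]
  calc _ ≤ ∫⁻ x in Ioi 0, (g x * initialAverage g x ^ (q - 1)) *
        (ENNReal.ofReal q * (primitive w x ^ (q - 1) * w x)) := by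
        refine lintegral_mono fun x => ?_
        have h1 : (1 : ℝ≥0∞) ≤ ENNReal.ofReal q := by
          rw [← ENNReal.ofReal_one]; exact ENNReal.ofReal_le_ofReal hq.le
        calc _ = 1 * (g x * initialAverage g x ^ (q - 1) * primitive w x ^ (q - 1) * w x) :=
              (one_mul _).symm
          _ ≤ ENNReal.ofReal q *
              (g x * initialAverage g x ^ (q - 1) * primitive w x ^ (q - 1) * w x) := by gcongr
          _ = _ := by ring
    _ ≤ ∫⁻ x in Ioi 0, (g x * initialAverage g x ^ (q - 1)) *
        (C * (ENNReal.ofReal q * ENNReal.ofReal x ^ (q - 1) *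
          ∫⁻ y in Ioi x, (u y : ℝ≥0∞) / ENNReal.ofReal y ^ q)) := by
        refine lintegral_mul_le_of_antitoneOn (antitoneOn_mul_initialAverage_rpow hg hq)
          (aemeasurable_primitive_rpow_mul hw) ((measurable_kernel q u).const_mul C).aemeasurable
          fun r hr => ?_
        rw [lintegral_const_mul' _ _ hC, lintegral_kernel hq hu hr, ← primitive_rpow hw hq]
        exact H r hr
    _ = _ := lintegral_congr fun x => by ring

/-- Chebyshev's inequality: `g^{**}(t) W(t) ≤ ∫ g w` for decreasing `g` and `w`. -/
theorem initialAverage_mul_primitive_le (hg : AntitoneOn g (Ioi 0)) (hw : AntitoneOn w (Ioi 0))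
    {t : ℝ} (ht : 0 < t) :
    initialAverage g t * primitive w t ≤ ∫⁻ x in Ioi 0, g x * w x := by
  have hwm := aemeasurable_restrict_of_antitoneOn (μ := volume) measurableSet_Ioi (antitoneOn_coe hw)
  -- Replacing w on (0, t) by its average there lowers every primitive, because averages of w
  -- decrease; the two primitives agree from t onwards.
  have key := lintegral_mul_le_of_antitoneOn hg
    (k₁ := (Ioo 0 t).indicator fun _ => initialAverage (fun x => (w x : ℝ≥0∞)) t)
    (k₂ := (Ioo 0 t).indicator fun x => (w x : ℝ≥0∞))
    (measurable_const.indicator measurableSet_Ioo).aemeasurable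
    (hwm.indicator measurableSet_Ioo) fun r hr => ?_
  · have hsub : Ioo 0 t ∩ Ioi 0 = Ioo 0 t := inter_eq_left.2 fun x hx => hx.1
    have e : ∀ k : ℝ → ℝ≥0∞, ∫⁻ x in Ioi 0, g x * (Ioo 0 t).indicator k x =
        ∫⁻ x in Ioo 0 t, g x * k x := by
      intro k
      simp_rw [← indicator_mul_right (Ioo 0 t) g (g := k)]
      rw [lintegral_indicator measurableSet_Ioo, Measure.restrict_restrict measurableSet_Ioo, hsub]
    rw [e, e] at key
    have hgm : AEMeasurable g (volume.restrict (Ioo 0 t)) :=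
      (aemeasurable_restrict_of_antitoneOn measurableSet_Ioi hg).mono_set fun x hx => hx.1
    rw [lintegral_mul_const'' _ hgm] at key
    calc _ = (∫⁻ x in Ioo 0 t, g x) * initialAverage (fun x => (w x : ℝ≥0∞)) t := by
          rw [initialAverage, initialAverage, primitive]; ring
      _ ≤ _ := key
      _ ≤ _ := lintegral_mono_set fun x hx => hx.1
  · have e : ∀ k : ℝ → ℝ≥0∞, ∫⁻ x in Ioo 0 r, (Ioo 0 t).indicator k x =
        ∫⁻ x in Ioo 0 (min r t), k x := by
      intro k
      rw [lintegral_indicator measurableSet_Ioo, Measure.restrict_restrict measurableSet_Ioo,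
        Ioo_inter_Ioo, max_self, min_comm]
    rw [e, e]
    have hm : 0 < min r t := lt_min hr ht
    calc _ = ENNReal.ofReal (min r t) * initialAverage (fun x => (w x : ℝ≥0∞)) t := by
          simp [mul_comm]
      _ ≤ ENNReal.ofReal (min r t) * initialAverage (fun x => (w x : ℝ≥0∞)) (min r t) := by
          gcongr
          exact initialAverage_antitoneOn (antitoneOn_coe hw) hm ht (min_le_right _ _)
      _ = _ := ofReal_mul_initialAverage _ _

/-- Left of t one has g**(x) ≥ g**(t); right of t one has x g**(x) ≥ t g**(t). These produce the two
terms of the fundamental function. -/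
theorem initialAverage_rpow_mul_fundamentalFn_le (hg : AntitoneOn g (Ioi 0)) (hq : 1 < q)
    (hu : AEMeasurable u (volume.restrict (Ioi 0))) {t : ℝ} (ht : 0 < t) :
    initialAverage g t ^ q * fundamentalFn q u t ≤
      ∫⁻ x in Ioi 0, initialAverage g x ^ q * u x := by
  have hq0 : 0 ≤ q := by linarith
  rw [← Ioo_union_Ici_eq_Ioi ht, lintegral_union measurableSet_Ici (by
    rw [Set.disjoint_left]; intro x hx hx'; exact absurd hx.2 (not_lt.2 hx')), fundamentalFn,
    mul_add]
  gcongr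
  · rw [primitive, ← lintegral_const_mul'' _ ((aemeasurable_coe hu).mono_set fun x hx => hx.1)]
    refine setLIntegral_mono' measurableSet_Ioo fun x hx => ?_
    gcongr
    exact initialAverage_antitoneOn hg hx.1 ht hx.2.le
  · rw [← mul_assoc, ← lintegral_const_mul'' _
      ((aemeasurable_div hu q).mono_set (Ioi_subset_Ioi ht.le))]
    refine (setLIntegral_mono' measurableSet_Ioi fun x hx => ?_).trans
      (lintegral_mono_set Ioi_subset_Ici_self)
    have hx0 : 0 < x := ht.trans hx
    rw [← ENNReal.mul_rpow_of_nonneg _ _ hq0, mul_comm (initialAverage g t),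
      ofReal_mul_initialAverage, mul_comm, ENNReal.div_eq_inv_mul, mul_comm, ← mul_assoc,
      ← ENNReal.inv_rpow, ← ENNReal.mul_rpow_of_nonneg _ _ hq0, mul_comm _ (_⁻¹)]
    gcongr
    rw [initialAverage]
    gcongr
    exact le_of_lt hx

end Core

/-! ### Decreasing functions as rearrangements. -/

section Rearrangement

variable {n : ℕ}

theorem antitone_rearr (f : EuclideanSpace ℝ (Fin n) → ℝ≥0) : Antitone (rearr f) :=
  fun _ _ hab => sInf_le_sInf fun _ hr => le_trans hr (ENNReal.ofReal_le_ofReal hab)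

/-- A finite-valued function with infinite rearrangement: every level is exceeded outside a ball, on
a set of infinite measure. It serves as the test function when a weight is degenerate. -/
theorem rearr_nnnorm (hn : 0 < n) (t : ℝ) :
    rearr (fun x : EuclideanSpace ℝ (Fin n) => ‖x‖₊) t = ∞ := by
  have : Nonempty (Fin n) := ⟨⟨0, hn⟩⟩
  refine sInf_eq_top.2 fun r hr => ?_
  by_contra hrtop
  lift r to ℝ≥0 using hrtop
  have hset : {x : EuclideanSpace ℝ (Fin n) | (r : ℝ≥0∞) < (‖x‖₊ : ℝ≥0∞)} =
      (Metric.closedBall 0 (r : ℝ))ᶜ := by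
    ext x
    simp [← NNReal.coe_lt_coe]
  have h1 : volume {x : EuclideanSpace ℝ (Fin n) | (r : ℝ≥0∞) < (‖x‖₊ : ℝ≥0∞)} ≤
      ENNReal.ofReal t := hr
  rw [hset, measure_compl measurableSet_closedBall measure_closedBall_lt_top.ne,
    measure_univ_of_isAddLeftInvariant, ENNReal.top_sub measure_closedBall_lt_top.ne] at h1
  exact absurd h1 (by simp)

/-- Every decreasing function that is finite on `(0, ∞)` is almost everywhere the decreasing
rearrangement of a radial function. -/
theorem exists_rearr_ae_eq (hn : 0 < n) {g : ℝ → ℝ≥0∞} (hg : Antitone g)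
    (hfin : ∀ t : ℝ, 0 < t → g t ≠ ∞) :
    ∃ f : EuclideanSpace ℝ (Fin n) → ℝ≥0, AEMeasurable f volume ∧
      rearr f =ᵐ[volume.restrict (Ioi 0)] g := by
  have : Nonempty (Fin n) := ⟨⟨0, hn⟩⟩
  set b : ℝ := (volume (Metric.ball (0 : EuclideanSpace ℝ (Fin n)) 1)).toReal
  have hb' : volume (Metric.ball (0 : EuclideanSpace ℝ (Fin n)) 1) ≠ ∞ := measure_ball_lt_top.ne
  have hb : 0 < b := ENNReal.toReal_pos (Metric.measure_ball_pos _ _ one_pos).ne' hb'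
  -- The volume of the ball centred at 0 through x, so that g ∘ κ is equimeasurable with g.
  set κ : EuclideanSpace ℝ (Fin n) → ℝ := fun x => ‖x‖ ^ n * b
  have hκ : Measurable κ := (measurable_norm.pow_const n).mul_const b
  have hvol : ∀ t : ℝ, 0 < t → volume {x | κ x ≤ t} = ENNReal.ofReal t := by
    intro t ht
    have hset : {x | κ x ≤ t} = Metric.closedBall 0 ((t / b) ^ (1 / (n : ℝ))) := by
      ext x
      simp only [mem_ofPred_eq, κ, mem_closedBall_zero_iff]
      rw [← le_div_iff₀ hb, ← Real.rpow_natCast, one_div,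
        Real.le_rpow_inv_iff_of_pos (norm_nonneg x) (by positivity) (by exact_mod_cast hn)]
    rw [hset, Measure.addHaar_closedBall _ _ (by positivity), finrank_euclideanSpace_fin,
      ← Real.rpow_natCast, ← Real.rpow_mul (by positivity), one_div,
      inv_mul_cancel₀ (by exact_mod_cast hn.ne'), Real.rpow_one, ← ENNReal.ofReal_toReal hb',
      ← ENNReal.ofReal_mul (by positivity)]
    congr 1
    field_simp
    rfl
  set f : EuclideanSpace ℝ (Fin n) → ℝ≥0 := fun x => (g (κ x)).toNNReal
  refine ⟨f, (hg.measurable.comp hκ).ennreal_toNNReal.aemeasurable, ?_⟩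
  have hle : ∀ t : ℝ, 0 < t → rearr f t ≤ g t := by
    intro t ht
    refine sInf_le ?_
    show volume {x | g t < (f x : ℝ≥0∞)} ≤ ENNReal.ofReal t
    rw [← hvol t ht]
    refine measure_mono fun x hx => ?_
    by_contra hxt
    exact absurd (lt_of_lt_of_le hx ENNReal.coe_toNNReal_le_self)
      (not_lt.2 (hg (le_of_lt (not_le.1 hxt))))
  have hge : ∀ t s : ℝ, 0 < t → t < s → g s ≤ rearr f t := by
    intro t s ht hts
    refine le_sInf fun r hr => ?_
    by_contra hrs
    rw [not_le] at hrs
    have h1 : {x | κ x ≤ s} \ {0} ⊆ {x | r < (f x : ℝ≥0∞)} := by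
      rintro x ⟨hx, hx0⟩
      have hpos : 0 < κ x := mul_pos (pow_pos (norm_pos_iff.2 hx0) n) hb
      show r < ((g (κ x)).toNNReal : ℝ≥0∞)
      rw [ENNReal.coe_toNNReal (hfin _ hpos)]
      exact lt_of_lt_of_le hrs (hg hx)
    have h2 := (measure_mono (μ := volume) h1).trans hr
    rw [measure_sdiff_null (measure_singleton _), hvol s (ht.trans hts),
      ENNReal.ofReal_le_ofReal_iff ht.le] at h2
    linarith
  -- The rearrangement at t lies between g(s), for every s > t, and g(t); these bounds meet at
  -- continuity points.
  have hc : ∀ᵐ t : ℝ, ContinuousAt g t := by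
    have := hg.countable_not_continuousAt.ae_notMem (volume : Measure ℝ)
    filter_upwards [this] with t ht
    by_contra h
    exact ht h
  rw [EventuallyEq, ae_restrict_iff' measurableSet_Ioi]
  filter_upwards [hc] with t htc ht
  refine le_antisymm (hle t ht) ?_
  refine le_of_tendsto (htc.tendsto.mono_left (nhdsWithin_le_nhds (s := Ioi t))) ?_
  filter_upwards [self_mem_nhdsWithin] with s hs
  exact hge t s ht hs

end Rearrangement

/-! ### Gliding hump: from set inclusion to a bound on characteristic functions. -/

section GlidingHump

theorem tsum_geometric_two_ne_top : ∑' k : ℕ, (2⁻¹ : ℝ≥0∞) ^ k ≠ ∞ := by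
  rw [ENNReal.tsum_geometric, ENNReal.one_sub_inv_two, inv_inv]
  exact ENNReal.ofNat_ne_top

theorem tsum_geometric_four_ne_top : ∑' k : ℕ, (4⁻¹ : ℝ≥0∞) ^ k ≠ ∞ := by
  refine ne_top_of_le_ne_top tsum_geometric_two_ne_top (ENNReal.tsum_le_tsum fun k => ?_)
  gcongr
  norm_num

/-- If membership with respect to a quasinorm `A` implies membership with respect to `B`, then
`B` is bounded by `A` on characteristic functions. -/
theorem exists_bound_of_finite_imp {n : ℕ} (hn : 0 < n) {A B : (ℝ → ℝ≥0∞) → ℝ≥0∞}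
    (hAcongr : ∀ g₁ g₂ : ℝ → ℝ≥0∞, g₁ =ᵐ[volume.restrict (Ioi 0)] g₂ → A g₁ = A g₂)
    (hBcongr : ∀ g₁ g₂ : ℝ → ℝ≥0∞, g₁ =ᵐ[volume.restrict (Ioi 0)] g₂ → B g₁ = B g₂)
    (hBmono : Monotone B)
    (hBsmul : ∀ c : ℝ≥0∞, c ≠ ∞ → ∀ g : ℝ → ℝ≥0∞, c * B g ≤ B (fun t => c * g t))
    (hAsmul : ∀ c : ℝ≥0∞, c ≠ ∞ → ∀ g : ℝ → ℝ≥0∞, A (fun t => c * g t) ≤ c * A g)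
    (hAsum : ∀ g : ℕ → ℝ → ℝ≥0∞, (∀ k, Antitone (g k)) → (∀ k, A (g k) ≤ 1) →
      A (fun t => ∑' k, 4⁻¹ ^ k * g k t) ≠ ∞)
    (hAfin : ∀ g : ℝ → ℝ≥0∞, Antitone g → A g ≠ ∞ → ∀ t : ℝ, 0 < t → g t ≠ ∞)
    (hsub : ∀ f : EuclideanSpace ℝ (Fin n) → ℝ≥0, AEMeasurable f volume →
      A (rearr f) < ∞ → B (rearr f) < ∞) :
    ∃ C : ℝ≥0, 0 < C ∧ ∀ r : ℝ, 0 < r → B (initialIndicator r) ≤ C * A (initialIndicator r) := by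
  by_contra hcon
  push Not at hcon
  have hanti : ∀ (c : ℝ≥0∞) (r : ℝ), Antitone fun t => c * initialIndicator r t :=
    fun c r a b hab => mul_le_mul_right (antitone_initialIndicator r hab) c
  have hsum_anti : ∀ g : ℕ → ℝ → ℝ≥0∞, (∀ k, Antitone (g k)) →
      Antitone (fun t => ∑' k, (4⁻¹ : ℝ≥0∞) ^ k * g k t) := fun g hg a b hab =>
    ENNReal.tsum_le_tsum fun k => mul_le_mul_right (hg k hab) _
  -- If A vanished on an indicator, its multiples by 4^k would still be admissible in `hAsum`; the
  -- weights 4^{-k} undo the factors and the sum is infinite at r/2, against `hAfin`.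
  have h0 : ∀ r : ℝ, 0 < r → A (initialIndicator r) ≠ 0 := by
    intro r hr hA
    refine hAfin _ (hsum_anti _ fun k => hanti (4 ^ k) r) (hAsum _ (fun k => hanti (4 ^ k) r)
      fun k => (hAsmul _ (by simp) _).trans (by rw [hA, mul_zero]; exact zero_le_one)) (r / 2)
      (by linarith) ?_
    have h1 : initialIndicator r (r / 2) = 1 := by
      simp [initialIndicator, show r / 2 < r by linarith]
    have h4 : ∀ k : ℕ, (4⁻¹ : ℝ≥0∞) ^ k * (4 ^ k * initialIndicator r (r / 2)) = 1 := by
      intro k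
      rw [h1, mul_one, ← mul_pow, ENNReal.inv_mul_cancel (by norm_num) (by norm_num), one_pow]
    simp_rw [h4]
    exact ENNReal.tsum_const_eq_top_of_ne_zero one_ne_zero
  -- The rate 8^k beats the summation weights 4^{-k}: the k-th term alone forces B of the sum to be
  -- at least 2^k.
  choose r hr hlt using fun k : ℕ => hcon (8 ^ k) (by positivity)
  set a : ℕ → ℝ≥0∞ := fun k => A (initialIndicator (r k)) with ha
  have ha0 : ∀ k, a k ≠ 0 := fun k => h0 _ (hr k)
  have hatop : ∀ k, a k ≠ ∞ := by
    intro k hk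
    have := hlt k
    rw [show A (initialIndicator (r k)) = ∞ from hk, ENNReal.mul_top (by simp)] at this
    exact not_top_lt this
  set G : ℝ → ℝ≥0∞ := fun t => ∑' k, 4⁻¹ ^ k * ((a k)⁻¹ * initialIndicator (r k) t) with hG
  have hGanti : Antitone G := hsum_anti _ fun k => hanti _ _
  have hAG : A G ≠ ∞ := by
    refine hAsum _ (fun k => hanti _ _) fun k => ?_
    refine (hAsmul _ (ENNReal.inv_ne_top.2 (ha0 k)) _).trans_eq ?_
    exact ENNReal.inv_mul_cancel (ha0 k) (hatop k)
  obtain ⟨f, hf, hfG⟩ := exists_rearr_ae_eq hn hGanti (hAfin G hGanti hAG)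
  have hBG : B G < ∞ := by
    rw [← hBcongr _ _ hfG]
    exact hsub f hf (by rw [hAcongr _ _ hfG]; exact hAG.lt_top)
  have hbig : ∀ k : ℕ, (2 : ℝ≥0∞) ^ k ≤ B G := by
    intro k
    have hc : (4⁻¹ : ℝ≥0∞) ^ k * (a k)⁻¹ ≠ ∞ :=
      ENNReal.mul_ne_top (ENNReal.pow_ne_top (by norm_num)) (ENNReal.inv_ne_top.2 (ha0 k))
    calc (2 : ℝ≥0∞) ^ k = 4⁻¹ ^ k * 8 ^ k := by
          rw [← mul_pow]
          congr 1
          rw [show (8 : ℝ≥0∞) = 4 * 2 by norm_num, ← mul_assoc,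
            ENNReal.inv_mul_cancel (by norm_num) (by norm_num), one_mul]
      _ = 4⁻¹ ^ k * (a k)⁻¹ * (8 ^ k * a k) := by
          rw [mul_assoc, mul_comm (8 ^ k) (a k), ← mul_assoc (a k)⁻¹,
            ENNReal.inv_mul_cancel (ha0 k) (hatop k), one_mul]
      _ ≤ 4⁻¹ ^ k * (a k)⁻¹ * B (initialIndicator (r k)) := by
          have := (hlt k).le
          push_cast at this
          gcongr
      _ ≤ B (fun t => 4⁻¹ ^ k * (a k)⁻¹ * initialIndicator (r k) t) := hBsmul _ hc _
      _ ≤ B G := hBmono fun t => by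
          rw [mul_assoc]
          exact ENNReal.le_tsum (f := fun k => (4⁻¹ : ℝ≥0∞) ^ k *
            ((a k)⁻¹ * initialIndicator (r k) t)) k
  obtain ⟨k, hk⟩ := ENNReal.exists_nat_gt hBG.ne
  refine absurd (hbig k) (not_le.2 (hk.trans ?_))
  exact_mod_cast k.lt_two_pow_self

end GlidingHump

/-! ### The quasinorms as functionals of the rearrangement. -/

section Functionals

variable {q : ℝ} {v w : ℝ → ℝ≥0}

/-- The `Γ^q(v)` quasinorm of a function with decreasing rearrangement `g`. -/
noncomputable def gammaProfile (q : ℝ) (v : ℝ → ℝ≥0) (g : ℝ → ℝ≥0∞) : ℝ≥0∞ :=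
  (∫⁻ t in Ioi (0 : ℝ), initialAverage g t ^ q * (v t : ℝ≥0∞)) ^ (1 / q)

/-- The `Λ¹(w)` norm of a function with decreasing rearrangement `g`. -/
noncomputable def lambdaProfile (w : ℝ → ℝ≥0) (g : ℝ → ℝ≥0∞) : ℝ≥0∞ :=
  ∫⁻ t in Ioi (0 : ℝ), g t * (w t : ℝ≥0∞)

/-- The `Γ^{1,∞}(w)` norm of a function with decreasing rearrangement `g`. -/
noncomputable def gammaWeakProfile (w : ℝ → ℝ≥0) (g : ℝ → ℝ≥0∞) : ℝ≥0∞ :=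
  ⨆ t ∈ Ioi (0 : ℝ), initialAverage g t * primitive w t

theorem lambdaNorm_one_eq {n : ℕ} (f : EuclideanSpace ℝ (Fin n) → ℝ≥0) :
    lambdaNorm 1 w f = lambdaProfile w (rearr f) := by
  simp [lambdaNorm, lambdaProfile]

theorem gammaWeakNorm_one_eq {n : ℕ} (f : EuclideanSpace ℝ (Fin n) → ℝ≥0) :
    gammaWeakNorm 1 w f = gammaWeakProfile w (rearr f) := by
  simp [gammaWeakNorm, gammaWeakProfile, maxRearr_eq]

theorem initialAverage_const_mul {c : ℝ≥0∞} (hc : c ≠ ∞) (g : ℝ → ℝ≥0∞) :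
    initialAverage (fun t => c * g t) = fun t => c * initialAverage g t := by
  ext t
  rw [initialAverage, lintegral_const_mul' _ _ hc, initialAverage]
  ring

theorem gammaProfile_const_mul (hq : 1 < q) {c : ℝ≥0∞} (hc : c ≠ ∞) (g : ℝ → ℝ≥0∞) :
    gammaProfile q v (fun t => c * g t) = c * gammaProfile q v g := by
  have hq0 : 0 < q := by linarith
  rw [gammaProfile, initialAverage_const_mul hc, gammaProfile]
  simp_rw [ENNReal.mul_rpow_of_nonneg _ _ hq0.le, mul_assoc]
  rw [lintegral_const_mul' _ _ (ENNReal.rpow_ne_top_of_nonneg hq0.le hc),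
    ENNReal.mul_rpow_of_nonneg _ _ (by positivity), ← ENNReal.rpow_mul, mul_one_div_cancel hq0.ne',
    ENNReal.rpow_one]

theorem lambdaProfile_const_mul {c : ℝ≥0∞} (hc : c ≠ ∞) (g : ℝ → ℝ≥0∞) :
    lambdaProfile w (fun t => c * g t) = c * lambdaProfile w g := by
  simp_rw [lambdaProfile, mul_assoc]
  exact lintegral_const_mul' _ _ hc

theorem gammaWeakProfile_const_mul {c : ℝ≥0∞} (hc : c ≠ ∞) (g : ℝ → ℝ≥0∞) :
    gammaWeakProfile w (fun t => c * g t) = c * gammaWeakProfile w g := by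
  simp_rw [gammaWeakProfile, initialAverage_const_mul hc, ENNReal.mul_iSup, mul_assoc]

theorem gammaProfile_mono (hq : 1 < q) : Monotone (gammaProfile q v) := by
  intro g₁ g₂ h
  unfold gammaProfile
  gcongr with t
  exact initialAverage_mono h t

theorem gammaWeakProfile_mono : Monotone (gammaWeakProfile w) := by
  intro g₁ g₂ h
  unfold gammaWeakProfile
  gcongr with t ht
  exact initialAverage_mono h t

/-- Split 4^{-k} = 2^{-k} · 2^{-k}: one factor bounds 2^{-k} a_k by the q-th root of the sum on the
right (as q > 1), the other makes the series converge. It replaces Minkowski's inequality for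
countable sums. -/
theorem tsum_rpow_le (hq : 1 < q) (a : ℕ → ℝ≥0∞) :
    (∑' k, 4⁻¹ ^ k * a k) ^ q ≤ (∑' k : ℕ, 2⁻¹ ^ k) ^ q * ∑' k, 2⁻¹ ^ k * a k ^ q := by
  have hq0 : 0 < q := by linarith
  set S := ∑' k, (2⁻¹ : ℝ≥0∞) ^ k * a k ^ q
  have h1 : ∀ k, 2⁻¹ ^ k * a k ≤ S ^ (1 / q) := by
    intro k
    rw [one_div, ENNReal.le_rpow_inv_iff hq0, ENNReal.mul_rpow_of_nonneg _ _ hq0.le]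
    refine le_trans ?_ (ENNReal.le_tsum k)
    gcongr
    calc ((2⁻¹ : ℝ≥0∞) ^ k) ^ q ≤ ((2⁻¹ : ℝ≥0∞) ^ k) ^ (1 : ℝ) :=
          ENNReal.rpow_le_rpow_of_exponent_ge (pow_le_one' (by norm_num) k) hq.le
      _ = _ := ENNReal.rpow_one _
  calc _ ≤ (∑' k, 2⁻¹ ^ k * S ^ (1 / q)) ^ q := by
        refine ENNReal.rpow_le_rpow (ENNReal.tsum_le_tsum fun k => ?_) hq0.le
        have : (4⁻¹ : ℝ≥0∞) = 2⁻¹ * 2⁻¹ := by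
          rw [← ENNReal.mul_inv (by norm_num) (by norm_num)]; norm_num
        rw [this, mul_pow, mul_assoc]
        gcongr
        exact h1 k
    _ = _ := by
        rw [ENNReal.tsum_mul_right, ENNReal.mul_rpow_of_nonneg _ _ hq0.le, ← ENNReal.rpow_mul,
          one_div_mul_cancel hq0.ne', ENNReal.rpow_one]

theorem gammaProfile_tsum_ne_top (hq : 1 < q) (hv : AEMeasurable v (volume.restrict (Ioi 0)))
    (g : ℕ → ℝ → ℝ≥0∞) (hg : ∀ k, Antitone (g k)) (h1 : ∀ k, gammaProfile q v (g k) ≤ 1) :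
    gammaProfile q v (fun t => ∑' k, 4⁻¹ ^ k * g k t) ≠ ∞ := by
  have hq0 : 0 < q := by linarith
  refine ENNReal.rpow_ne_top_of_nonneg (by positivity) ?_
  have havg : ∀ t, initialAverage (fun t => ∑' k, 4⁻¹ ^ k * g k t) t =
      ∑' k, 4⁻¹ ^ k * initialAverage (g k) t := by
    intro t
    rw [initialAverage, lintegral_tsum fun k => ((hg k).measurable.const_mul _).aemeasurable,
      ← ENNReal.tsum_mul_left]
    refine tsum_congr fun k => ?_
    rw [lintegral_const_mul _ (hg k).measurable, initialAverage]
    ring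
  have hm : ∀ k, AEMeasurable (fun t => 2⁻¹ ^ k * (initialAverage (g k) t ^ q * (v t : ℝ≥0∞)))
      (volume.restrict (Ioi 0)) := fun k =>
    (((aemeasurable_restrict_of_antitoneOn measurableSet_Ioi
      (initialAverage_antitoneOn ((hg k).antitoneOn _))).pow_const q).mul
      (aemeasurable_coe hv)).const_mul _
  have hc : (∑' k : ℕ, (2⁻¹ : ℝ≥0∞) ^ k) ^ q ≠ ∞ :=
    ENNReal.rpow_ne_top_of_nonneg hq0.le tsum_geometric_two_ne_top
  refine ne_top_of_le_ne_top (ENNReal.mul_ne_top hc tsum_geometric_two_ne_top) ?_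
  calc _ ≤ ∫⁻ t in Ioi 0, (∑' k : ℕ, (2⁻¹ : ℝ≥0∞) ^ k) ^ q *
        ∑' k, 2⁻¹ ^ k * (initialAverage (g k) t ^ q * (v t : ℝ≥0∞)) := by
        refine lintegral_mono fun t => ?_
        rw [havg]
        refine (mul_le_mul_left (tsum_rpow_le hq _) _).trans_eq ?_
        rw [mul_assoc, ← ENNReal.tsum_mul_right]
        simp_rw [mul_assoc]
    _ = (∑' k : ℕ, (2⁻¹ : ℝ≥0∞) ^ k) ^ q *
        ∑' k, 2⁻¹ ^ k * ∫⁻ t in Ioi 0, (initialAverage (g k) t ^ q * (v t : ℝ≥0∞)) := by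
        rw [lintegral_const_mul' _ _ hc, lintegral_tsum hm]
        congr 1
        refine tsum_congr fun k => lintegral_const_mul' _ _ (ENNReal.pow_ne_top (by norm_num))
    _ ≤ _ := by
        gcongr with k
        refine mul_le_of_le_one_right' ?_
        have := h1 k
        rwa [gammaProfile, one_div, ENNReal.rpow_inv_le_iff hq0, ENNReal.one_rpow] at this

theorem lambdaProfile_tsum_ne_top (hw : AEMeasurable w (volume.restrict (Ioi 0)))
    (g : ℕ → ℝ → ℝ≥0∞) (hg : ∀ k, Antitone (g k)) (h1 : ∀ k, lambdaProfile w (g k) ≤ 1) :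
    lambdaProfile w (fun t => ∑' k, 4⁻¹ ^ k * g k t) ≠ ∞ := by
  refine ne_top_of_le_ne_top tsum_geometric_four_ne_top ?_
  unfold lambdaProfile
  simp_rw [← ENNReal.tsum_mul_right, mul_assoc]
  have hm : ∀ k, AEMeasurable (fun t => 4⁻¹ ^ k * (g k t * (w t : ℝ≥0∞)))
      (volume.restrict (Ioi 0)) := fun k =>
    (((hg k).measurable.aemeasurable).mul (aemeasurable_coe hw)).const_mul _
  rw [lintegral_tsum hm]
  refine ENNReal.tsum_le_tsum fun k => ?_
  rw [lintegral_const_mul' _ _ (ENNReal.pow_ne_top (by norm_num))]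
  exact mul_le_of_le_one_right' (h1 k)

theorem initialAverage_eq_top {g : ℝ → ℝ≥0∞} (hg : AntitoneOn g (Ioi 0)) {t s : ℝ} (ht : 0 < t)
    (hs : 0 < s) (hgt : g t = ∞) : initialAverage g s = ∞ := by
  have h1 : ∫⁻ u in Ioo 0 t, g u = ∞ := by
    have := mul_le_lintegral_Ioo hg ht
    rwa [hgt, ENNReal.top_mul (by simpa using ht), top_le_iff] at this
  rw [initialAverage, setLIntegral_Ioo_eq_top_of_antitoneOn hg hs h1, ENNReal.mul_top (by simp)]

theorem lintegral_eq_top_of_top_mul {v : ℝ → ℝ≥0} {k : ℝ → ℝ≥0∞} {S : Set ℝ}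
    (hS : MeasurableSet S) (hk : ∀ x ∈ S, k x = ∞) (h0 : ∫⁻ x in S, (v x : ℝ≥0∞) ≠ 0) :
    ∫⁻ x in S, k x * v x = ∞ := by
  refine top_le_iff.1 ?_
  calc (∞ : ℝ≥0∞) = ∞ * ∫⁻ x in S, (v x : ℝ≥0∞) := (ENNReal.top_mul h0).symm
    _ ≤ ∫⁻ x in S, ∞ * (v x : ℝ≥0∞) := lintegral_const_mul_le _ _
    _ = _ := setLIntegral_congr_fun hS fun x hx => by simp [hk x hx]

/-- An infinite value at t is only inherited to the left, so mass of w near 0 is required. In the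
Γ^q counterpart the average becomes infinite everywhere, and it suffices that v is not null. -/
theorem ne_top_of_lambdaProfile_ne_top (hw : ∀ t : ℝ, 0 < t → primitive w t ≠ 0)
    (g : ℝ → ℝ≥0∞) (hg : Antitone g) (h : lambdaProfile w g ≠ ∞) (t : ℝ) (ht : 0 < t) :
    g t ≠ ∞ := by
  intro hgt
  refine h (top_le_iff.1 ?_)
  rw [← lintegral_eq_top_of_top_mul (k := g) measurableSet_Ioo
    (fun x hx => top_le_iff.1 (hgt ▸ hg (le_of_lt hx.2))) (hw t ht)]
  exact lintegral_mono_set fun x hx => hx.1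

theorem ne_top_of_gammaProfile_ne_top (hq : 1 < q) (hv : ∫⁻ x in Ioi 0, (v x : ℝ≥0∞) ≠ 0)
    (g : ℝ → ℝ≥0∞) (hg : Antitone g) (h : gammaProfile q v g ≠ ∞) (t : ℝ) (ht : 0 < t) :
    g t ≠ ∞ := by
  intro hgt
  refine h ?_
  have hq0 : 0 < q := by linarith
  rw [gammaProfile, lintegral_eq_top_of_top_mul (k := fun x => initialAverage g x ^ q)
    measurableSet_Ioi (fun x hx => ?_) hv, ENNReal.top_rpow_of_pos (by positivity)]
  rw [initialAverage_eq_top (hg.antitoneOn _) ht hx hgt, ENNReal.top_rpow_of_pos hq0]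

end Functionals

/-! ### Consequences of the set inclusions, and the obstruction when w does not vanish at infinity.
-/

section Inclusions

variable {n : ℕ} {q : ℝ} {v w : ℝ → ℝ≥0}

theorem lambdaProfile_initialIndicator {r : ℝ} :
    lambdaProfile w (initialIndicator r) = primitive w r := by
  have : Ioo 0 r = Iio r ∩ Ioi 0 := by ext; simp [and_comm]
  rw [lambdaProfile, primitive, this, ← Measure.restrict_restrict measurableSet_Iio,
    ← lintegral_indicator measurableSet_Iio]
  refine lintegral_congr fun x => ?_
  by_cases hx : x < r <;> simp [initialIndicator, hx]

theorem gammaProfile_initialIndicator (hq : 1 < q) {r : ℝ} (hr : 0 < r) :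
    gammaProfile q v (initialIndicator r) = fundamentalFn q v r ^ (1 / q) := by
  rw [gammaProfile, lintegral_initialAverage_initialIndicator hq hr]

theorem primitive_le_gammaWeakProfile {r : ℝ} (hr : 0 < r) :
    primitive w r ≤ gammaWeakProfile w (initialIndicator r) := by
  refine le_trans ?_ (le_iSup₂ (f := fun t (_ : t ∈ Ioi (0 : ℝ)) =>
    initialAverage (initialIndicator r) t * primitive w t) r hr)
  rw [initialAverage_initialIndicator_of_le hr le_rfl, one_mul]

theorem aemeasurable_nnnorm : AEMeasurable (fun x : EuclideanSpace ℝ (Fin n) => ‖x‖₊) volume :=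
  measurable_nnnorm.aemeasurable

theorem initialAverage_rearr_nnnorm (hn : 0 < n) {t : ℝ} (ht : 0 < t) :
    initialAverage (rearr fun x : EuclideanSpace ℝ (Fin n) => ‖x‖₊) t = ∞ :=
  initialAverage_eq_top ((antitone_rearr _).antitoneOn _) ht ht (rearr_nnnorm hn t)

theorem primitive_eq_zero_of_antitoneOn (hw : AntitoneOn w (Ioi 0)) {t : ℝ} (ht : 0 < t)
    (h : primitive w t = 0) {r : ℝ} (hr : 0 < r) : primitive w r = 0 := by
  rcases le_total r t with hrt | hrt
  · exact le_antisymm (h ▸ monotone_primitive w hrt) zero_le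
  · have h1 := initialAverage_antitoneOn (antitoneOn_coe hw) ht hr hrt
    have h2 : initialAverage (fun x => (w x : ℝ≥0∞)) t = 0 := by
      rw [initialAverage]
      exact mul_eq_zero_of_right _ h
    rw [h2, nonpos_iff_eq_zero] at h1
    rw [primitive, ← ofReal_mul_initialAverage, h1, mul_zero]

theorem lintegral_mul_eq_zero {S : Set ℝ} (hv : AEMeasurable v (volume.restrict S))
    (h : ∫⁻ x in S, (v x : ℝ≥0∞) = 0) (k : ℝ → ℝ≥0∞) : ∫⁻ x in S, k x * v x = 0 := by
  have hm : AEMeasurable (fun x => (v x : ℝ≥0∞)) (volume.restrict S) :=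
    measurable_coe_nnreal_ennreal.comp_aemeasurable hv
  rw [lintegral_eq_zero_iff' hm] at h
  rw [← lintegral_zero (μ := volume.restrict S)]
  refine lintegral_congr_ae ?_
  filter_upwards [h] with x hx
  have : (v x : ℝ≥0∞) = 0 := hx
  rw [this, mul_zero]

/-- The set inclusions `Λ¹(w) ⊆ Γ^q(v) ⊆ Γ^{1,∞}(w)` determine the fundamental function
of `Γ^q(v)`. -/
theorem fundamentalEquiv_of_subset (hn : 0 < n) (hq : 1 < q) (hw : IsWeight w)
    (hdec : AntitoneOn w (Ioi 0)) (hv : IsWeight v) (h₁ : Lambda n 1 w ⊆ Gamma n q v)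
    (h₂ : Gamma n q v ⊆ GammaWeak n 1 w) : FundamentalEquiv q w v := by
  have hq0 : 0 < q := by linarith
  have hs₁ : ∀ f : EuclideanSpace ℝ (Fin n) → ℝ≥0, AEMeasurable f volume →
      lambdaProfile w (rearr f) < ∞ → gammaProfile q v (rearr f) < ∞ := fun f hf h =>
    (h₁ (show f ∈ Lambda n 1 w from ⟨hf, by rwa [lambdaNorm_one_eq]⟩)).2
  have hs₂ : ∀ f : EuclideanSpace ℝ (Fin n) → ℝ≥0, AEMeasurable f volume →
      gammaProfile q v (rearr f) < ∞ → gammaWeakProfile w (rearr f) < ∞ := fun f hf h => by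
    rw [← gammaWeakNorm_one_eq]
    exact (h₂ (show f ∈ Gamma n q v from ⟨hf, h⟩)).2
  by_cases hW : ∀ t : ℝ, 0 < t → primitive w t ≠ 0
  -- If v were null, the Euclidean norm would lie in Γ^q(v), yet its weak norm is infinite because
  -- W(1) is positive.
  · have hv0 : ∫⁻ x in Ioi 0, (v x : ℝ≥0∞) ≠ 0 := by
      intro h0
      have h := hs₂ _ aemeasurable_nnnorm (by
        rw [gammaProfile, lintegral_mul_eq_zero hv.aemeasurable h0,
          ENNReal.zero_rpow_of_pos (by positivity)]
        exact ENNReal.zero_lt_top)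
      refine absurd h (not_lt.2 ?_)
      refine le_trans ?_ (le_iSup₂ (f := fun t (_ : t ∈ Ioi (0 : ℝ)) =>
        initialAverage (rearr fun x : EuclideanSpace ℝ (Fin n) => ‖x‖₊) t * primitive w t) 1
        (mem_Ioi.2 one_pos))
      rw [initialAverage_rearr_nnnorm hn one_pos, ENNReal.top_mul (hW 1 one_pos)]
    have hγ : ∀ g₁ g₂ : ℝ → ℝ≥0∞, g₁ =ᵐ[volume.restrict (Ioi 0)] g₂ →
        gammaProfile q v g₁ = gammaProfile q v g₂ := fun g₁ g₂ h => by
      rw [gammaProfile, initialAverage_congr h, gammaProfile]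
    obtain ⟨C₁, hC₁, H₁⟩ := exists_bound_of_finite_imp hn
      (A := lambdaProfile w) (B := gammaProfile q v)
      (fun g₁ g₂ h => lintegral_congr_ae (h.mono fun x hx => by simp only [hx])) hγ
      (gammaProfile_mono hq) (fun c hc g => (gammaProfile_const_mul hq hc g).ge)
      (fun c hc g => (lambdaProfile_const_mul hc g).le)
      (lambdaProfile_tsum_ne_top hw.aemeasurable) (ne_top_of_lambdaProfile_ne_top hW) hs₁
    obtain ⟨C₂, hC₂, H₂⟩ := exists_bound_of_finite_imp hn
      (A := gammaProfile q v) (B := gammaWeakProfile w) hγ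
      (fun g₁ g₂ h => by rw [gammaWeakProfile, initialAverage_congr h, gammaWeakProfile])
      gammaWeakProfile_mono (fun c hc g => (gammaWeakProfile_const_mul hc g).ge)
      (fun c hc g => (gammaProfile_const_mul hq hc g).le)
      (gammaProfile_tsum_ne_top hq hv.aemeasurable) (ne_top_of_gammaProfile_ne_top hq hv0) hs₂
    refine ⟨max (C₁ ^ q) (C₂ ^ q), lt_max_of_lt_left (NNReal.rpow_pos hC₁), fun r hr => ⟨?_, ?_⟩⟩
    · have h := (primitive_le_gammaWeakProfile (w := w) hr).trans (H₂ r hr)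
      rw [gammaProfile_initialIndicator hq hr] at h
      have h' := ENNReal.rpow_le_rpow h hq0.le
      rw [ENNReal.mul_rpow_of_nonneg _ _ hq0.le, ← ENNReal.rpow_mul, one_div_mul_cancel hq0.ne',
        ENNReal.rpow_one, ← ENNReal.coe_rpow_of_nonneg _ hq0.le] at h'
      exact h'.trans (mul_le_mul_left (ENNReal.coe_le_coe.2 (le_max_right _ _)) _)
    · have h := H₁ r hr
      rw [gammaProfile_initialIndicator hq hr, lambdaProfile_initialIndicator] at h
      have h' := ENNReal.rpow_le_rpow h hq0.le
      rw [ENNReal.mul_rpow_of_nonneg _ _ hq0.le, ← ENNReal.rpow_mul, one_div_mul_cancel hq0.ne',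
        ENNReal.rpow_one, ← ENNReal.coe_rpow_of_nonneg _ hq0.le] at h'
      exact h'.trans (mul_le_mul_left (ENNReal.coe_le_coe.2 (le_max_left _ _)) _)
  -- W(r)/r is decreasing, so one zero of W makes w null. Then Λ¹(w) contains the Euclidean norm,
  -- which forces v to be null as well, and both sides of the equivalence vanish.
  · push Not at hW
    obtain ⟨t, ht, htW⟩ := hW
    have hW0 : ∀ r : ℝ, 0 < r → primitive w r = 0 := fun r hr =>
      primitive_eq_zero_of_antitoneOn hdec ht htW hr
    have hw0 : ∫⁻ x in Ioi 0, (w x : ℝ≥0∞) = 0 := by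
      rw [setLIntegral_Ioi_eq_iSup]
      exact iSup_eq_bot.2 fun m => hW0 _ (by positivity)
    have hv0 : ∫⁻ x in Ioi 0, (v x : ℝ≥0∞) = 0 := by
      by_contra h0
      have h := hs₁ _ aemeasurable_nnnorm (by
        rw [lambdaProfile, lintegral_mul_eq_zero hw.aemeasurable hw0]
        exact ENNReal.zero_lt_top)
      exact ne_top_of_gammaProfile_ne_top hq h0 _ (antitone_rearr _) h.ne 1 one_pos
        (rearr_nnnorm hn 1)
    refine ⟨1, one_pos, fun r hr => ?_⟩
    have hf : fundamentalFn q v r = 0 := by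
      rw [← lintegral_initialAverage_initialIndicator hq hr]
      exact lintegral_mul_eq_zero hv.aemeasurable hv0 _
    rw [← fundamentalFn, hf, hW0 r hr, ENNReal.zero_rpow_of_pos hq0]
    simp

/-- After division by rᵠ the integrand is min(1/r, 1/x)^q v(x), which tends to 0 pointwise and is
dominated by its value at r = 1. -/
theorem tendsto_fundamentalFn_div (hq : 1 < q) (hv : AEMeasurable v (volume.restrict (Ioi 0)))
    (h : fundamentalFn q v 1 ≠ ∞) :
    Tendsto (fun m : ℕ => (ENNReal.ofReal (m + 1))⁻¹ ^ q * fundamentalFn q v (m + 1)) atTop (𝓝 0) := by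
  have hq0 : 0 < q := by linarith
  have hm : ∀ r, AEMeasurable (fun x => initialAverage (initialIndicator r) x)
      (volume.restrict (Ioi 0)) := fun r => aemeasurable_restrict_of_antitoneOn measurableSet_Ioi
    (initialAverage_antitoneOn ((antitone_initialIndicator r).antitoneOn _))
  have hle : ∀ r x : ℝ, 0 < r → 0 < x → initialAverage (initialIndicator r) x ≤ 1 := by
    intro r x hr hx
    rw [initialAverage, lintegral_initialIndicator, ← ENNReal.inv_mul_cancel
      (a := ENNReal.ofReal x) (by simpa using hx) (by simp)]
    gcongr
    exact min_le_left _ _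
  have key : Tendsto (fun m : ℕ => ∫⁻ x in Ioi 0, (ENNReal.ofReal (m + 1))⁻¹ ^ q *
      (initialAverage (initialIndicator (m + 1)) x ^ q * v x)) atTop
      (𝓝 (∫⁻ _ in Ioi (0 : ℝ), 0)) := by
    refine tendsto_lintegral_of_dominated_convergence'
      (fun x => initialAverage (initialIndicator 1) x ^ q * v x) ?_ ?_ ?_ ?_
    · exact fun m =>
        (((hm _).pow_const q).mul (aemeasurable_coe hv)).const_mul _
    · intro m
      set r : ℝ := m + 1
      have hr : 1 ≤ r := by simp [r]
      refine (ae_restrict_iff' measurableSet_Ioi).2 (ae_of_all _ fun x hx => ?_)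
      have hr0 : 0 < r := by linarith
      beta_reduce
      rw [← mul_assoc, ← ENNReal.mul_rpow_of_nonneg _ _ hq0.le]
      gcongr
      rw [initialAverage, initialAverage, lintegral_initialIndicator, lintegral_initialIndicator,
        ← mul_assoc, mul_comm (_)⁻¹, mul_assoc]
      gcongr
      rw [← ENNReal.ofReal_inv_of_pos hr0, ← ENNReal.ofReal_mul (by positivity)]
      refine ENNReal.ofReal_le_ofReal ?_
      rw [inv_mul_le_iff₀ hr0]
      rcases min_choice x 1 with h1 | h1 <;> rw [h1]
      · refine (min_le_left _ _).trans ?_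
        have : (0 : ℝ) < x := hx
        nlinarith
      · simp
    · rwa [lintegral_initialAverage_initialIndicator hq one_pos]
    · refine (ae_restrict_iff' measurableSet_Ioi).2 (ae_of_all _ fun x hx => ?_)
      have hlim : Tendsto (fun m : ℕ => (ENNReal.ofReal (m + 1))⁻¹ ^ q * (v x : ℝ≥0∞)) atTop (𝓝 0) := by
        have h1 : Tendsto (fun m : ℕ => (ENNReal.ofReal ((m : ℝ) + 1))⁻¹) atTop (𝓝 0) := by
          rw [← ENNReal.inv_top]
          refine tendsto_inv_iff.2 (ENNReal.tendsto_ofReal_atTop.comp ?_)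
          exact tendsto_atTop_add_const_right _ _ tendsto_natCast_atTop_atTop
        have h2 := (ENNReal.continuous_rpow_const (y := q)).tendsto 0 |>.comp h1
        rw [ENNReal.zero_rpow_of_pos hq0] at h2
        have h3 := ENNReal.Tendsto.mul_const h2 (b := (v x : ℝ≥0∞)) (Or.inr ENNReal.coe_ne_top)
        rwa [zero_mul] at h3
      refine tendsto_of_tendsto_of_tendsto_of_le_of_le' tendsto_const_nhds hlim
        (Eventually.of_forall fun _ => zero_le) (Eventually.of_forall fun m => ?_)
      gcongr
      exact mul_le_of_le_one_left' (ENNReal.rpow_le_one (hle _ x (by positivity) hx) hq0.le)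
  rw [lintegral_zero] at key
  refine key.congr fun m => ?_
  have hr : (0 : ℝ) < m + 1 := by positivity
  rw [← lintegral_initialAverage_initialIndicator hq hr, lintegral_const_mul' _ _ ?_]
  exact ENNReal.rpow_ne_top_of_nonneg hq0.le (ENNReal.inv_ne_top.2 (by simpa using hr))

/-- Here W(r) ≥ cr, so the equivalence would keep the fundamental function above a multiple of rᵠ.
-/
theorem not_fundamentalEquiv_of_tendsto_pos (hq : 1 < q) (hw : IsWeight w)
    (hdec : AntitoneOn w (Ioi 0)) (hv : IsWeight v) {c : ℝ≥0} (hc : 0 < c)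
    (hlim : Tendsto w atTop (𝓝 c)) : ¬ FundamentalEquiv q w v := by
  rintro ⟨C, -, H⟩
  have hq0 : 0 < q := by linarith
  have hwc : ∀ x ∈ Ioi (0 : ℝ), c ≤ w x := fun x hx => by
    refine le_of_tendsto hlim ?_
    filter_upwards [eventually_ge_atTop x] with y hy
    exact hdec hx (lt_of_lt_of_le hx hy) hy
  have hW : ∀ r : ℝ, c * ENNReal.ofReal r ≤ primitive w r := fun r => by
    calc _ = ∫⁻ _ in Ioo 0 r, (c : ℝ≥0∞) := by simp
      _ ≤ _ := setLIntegral_mono' measurableSet_Ioo fun x hx => ENNReal.coe_le_coe.2 (hwc x hx.1)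
  have h1 : fundamentalFn q v 1 ≠ ∞ := ne_top_of_le_ne_top (ENNReal.mul_ne_top ENNReal.coe_ne_top
    (ENNReal.rpow_ne_top_of_nonneg hq0.le (hw.primitive_ne_top 1))) (H 1 one_pos).2
  have h2 := ENNReal.Tendsto.const_mul (tendsto_fundamentalFn_div hq hv.aemeasurable h1)
    (a := (C : ℝ≥0∞)) (Or.inr ENNReal.coe_ne_top)
  rw [mul_zero] at h2
  have h3 : (c : ℝ≥0∞) ^ q ≤ 0 := by
    refine ge_of_tendsto h2 (Eventually.of_forall fun m => ?_)
    set r : ℝ := m + 1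
    have hr : 0 < r := by positivity
    have hr' : ENNReal.ofReal r ≠ 0 := by simpa using hr
    calc (c : ℝ≥0∞) ^ q = ((ENNReal.ofReal r)⁻¹ * (c * ENNReal.ofReal r)) ^ q := by
          rw [mul_comm (c : ℝ≥0∞), ← mul_assoc, ENNReal.inv_mul_cancel hr' (by simp), one_mul]
      _ ≤ ((ENNReal.ofReal r)⁻¹ * primitive w r) ^ q := by gcongr; exact hW r
      _ = (ENNReal.ofReal r)⁻¹ ^ q * primitive w r ^ q := ENNReal.mul_rpow_of_nonneg _ _ hq0.le
      _ ≤ (ENNReal.ofReal r)⁻¹ ^ q * (C * fundamentalFn q v r) := by gcongr; exact (H r hr).1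
      _ = _ := by ring
  rw [nonpos_iff_eq_zero, ENNReal.rpow_eq_zero_iff_of_pos hq0] at h3
  exact hc.ne' (by exact_mod_cast h3)

end Inclusions

/-! ### Frullani integrals of a decreasing function. -/

theorem setLIntegral_comp_two_mul {S : Set ℝ} (hS : MeasurableSet S) (f : ℝ → ℝ≥0∞) :
    ∫⁻ x in S, f x = 2 * ∫⁻ x in (fun x => 2 * x) ⁻¹' S, f (2 * x) := by
  have hm : Measurable fun x : ℝ => 2 * x := measurable_const_mul 2
  have he : MeasurableEmbedding fun x : ℝ => 2 * x :=
    (Homeomorph.mulLeft₀ (2 : ℝ) two_ne_zero).measurableEmbedding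
  have h1 : ∫⁻ x, S.indicator f (2 * x) = 2⁻¹ * ∫⁻ x, S.indicator f x := by
    rw [← he.lintegral_map, Real.map_volume_mul_left two_ne_zero, lintegral_smul_measure,
      smul_eq_mul]
    congr 1
    rw [abs_of_pos (by norm_num), ENNReal.ofReal_inv_of_pos two_pos]
    simp
  rw [← lintegral_indicator hS, ← lintegral_indicator (hm hS)]
  have h2 : ∀ x : ℝ, ((fun x => 2 * x) ⁻¹' S).indicator (fun x => f (2 * x)) x =
      S.indicator f (2 * x) := fun x => rfl
  simp_rw [h2]
  rw [h1, ← mul_assoc, ENNReal.mul_inv_cancel two_ne_zero ENNReal.ofNat_ne_top, one_mul]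

theorem setLIntegral_Ioi_eq_iSup_Ioc (s : ℝ) (k : ℝ → ℝ≥0∞) :
    ∫⁻ x in Ioi s, k x = ⨆ m : ℕ, ∫⁻ x in Ioc s (s + m), k x := by
  have : Ioi s = ⋃ m : ℕ, Ioc s (s + m) := by
    ext x
    simp only [mem_Ioi, mem_iUnion, mem_Ioc]
    refine ⟨fun hx => ?_, fun ⟨_, h, _⟩ => h⟩
    obtain ⟨m, hm⟩ := exists_nat_gt (x - s)
    exact ⟨m, hx, by linarith⟩
  rw [this, setLIntegral_iUnion_of_directed]
  refine directed_of_isDirected_le fun a b hab => Ioc_subset_Ioc_right ?_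
  have : (a : ℝ) ≤ b := by exact_mod_cast hab
  linarith

section Frullani

variable {h : ℝ → ℝ≥0∞}

theorem setLIntegral_div_le (hh : AntitoneOn h (Ioi 0)) {a b : ℝ} (ha : 0 < a) :
    ∫⁻ x in Ioc a b, h x / ENNReal.ofReal x ≤
      h a / ENNReal.ofReal a * ENNReal.ofReal (b - a) :=
  calc _ ≤ ∫⁻ _ in Ioc a b, h a / ENNReal.ofReal a :=
        setLIntegral_mono' measurableSet_Ioc fun x hx => ENNReal.div_le_div
          (hh ha (ha.trans hx.1) hx.1.le) (ENNReal.ofReal_le_ofReal hx.1.le)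
    _ = _ := by simp

theorem setLIntegral_div_two_mul_le (hh : AntitoneOn h (Ioi 0)) {s : ℝ} (hs : 0 < s) :
    ∫⁻ x in Ioc s (2 * s), h x / ENNReal.ofReal x ≤ h s := by
  refine (setLIntegral_div_le hh hs).trans_eq ?_
  rw [show 2 * s - s = s by ring, ENNReal.div_mul_cancel (by simpa using hs) (by simp)]

theorem le_setLIntegral_div_two_mul (hh : AntitoneOn h (Ioi 0)) {s : ℝ} (hs : 0 < s) :
    h (2 * s) / 2 ≤ ∫⁻ x in Ioc s (2 * s), h x / ENNReal.ofReal x :=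
  calc h (2 * s) / 2 = ∫⁻ _ in Ioc s (2 * s), h (2 * s) / ENNReal.ofReal (2 * s) := by
        have hs0 : ENNReal.ofReal s ≠ 0 := by simpa using hs
        rw [setLIntegral_const, Real.volume_Ioc, show 2 * s - s = s by ring,
          ENNReal.ofReal_mul zero_le_two, div_eq_mul_inv, div_eq_mul_inv,
          ENNReal.mul_inv (Or.inr (by simp)) (Or.inr hs0), mul_assoc, mul_assoc,
          ENNReal.inv_mul_cancel hs0 (by simp)]
        simp
    _ ≤ _ := setLIntegral_mono' measurableSet_Ioc fun x hx => ENNReal.div_le_div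
        (hh (hs.trans hx.1) (by simpa using hs) hx.2) (ENNReal.ofReal_le_ofReal hx.2)

/-- The measure dx/x is invariant under x ↦ 2x, so the h(2x) part is the integral of h over the
doubled interval. The additive form avoids truncated subtraction. -/
theorem lintegral_frullani_add (hh : AntitoneOn h (Ioi 0)) {s R : ℝ} (hs : 0 < s) :
    (∫⁻ x in Ioc s R, (h x - h (2 * x)) / ENNReal.ofReal x) +
      ∫⁻ x in Ioc (2 * s) (2 * R), h x / ENNReal.ofReal x =
      ∫⁻ x in Ioc s R, h x / ENNReal.ofReal x := by
  have hpre : (fun x : ℝ => 2 * x) ⁻¹' Ioc (2 * s) (2 * R) = Ioc s R := by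
    ext x
    simp
  have hsub : Ioc s R ⊆ Ioi 0 := fun x hx => hs.trans hx.1
  have h2 : AntitoneOn (fun x => h (2 * x)) (Ioi 0) := fun a ha b hb hab => by
    rw [mem_Ioi] at ha hb
    exact hh (mem_Ioi.2 (by linarith)) (mem_Ioi.2 (by linarith)) (by linarith)
  have hm : AEMeasurable (fun x => h (2 * x) / ENNReal.ofReal x) (volume.restrict (Ioc s R)) :=
    ((aemeasurable_restrict_of_antitoneOn measurableSet_Ioi h2).mono_set hsub).div
      ENNReal.measurable_ofReal.aemeasurable
  rw [setLIntegral_comp_two_mul (S := Ioc (2 * s) (2 * R)) measurableSet_Ioc, hpre, ← lintegral_const_mul' _ _ (by simp)]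
  have e : ∀ x ∈ Ioc s R, 2 * (h (2 * x) / ENNReal.ofReal (2 * x)) =
      h (2 * x) / ENNReal.ofReal x := fun x hx => by
    have hx0 : ENNReal.ofReal x ≠ 0 := by simpa using hs.trans hx.1
    rw [ENNReal.ofReal_mul zero_le_two, div_eq_mul_inv, div_eq_mul_inv,
      ENNReal.mul_inv (Or.inr (by simp)) (Or.inr hx0), mul_left_comm, ← mul_assoc 2]
    simp [ENNReal.mul_inv_cancel]
  rw [setLIntegral_congr_fun measurableSet_Ioc e, ← lintegral_add_right' _ hm]
  refine setLIntegral_congr_fun measurableSet_Ioc fun x hx => ?_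
  have hx0 : 0 < x := hs.trans hx.1
  rw [← ENNReal.add_div, tsub_add_cancel_of_le (hh hx0 (mem_Ioi.2 (by linarith)) (by linarith))]

theorem setLIntegral_div_ne_top (hh : AntitoneOn h (Ioi 0)) (hfin : ∀ t : ℝ, 0 < t → h t ≠ ∞)
    {a b : ℝ} (ha : 0 < a) : ∫⁻ x in Ioc a b, h x / ENNReal.ofReal x ≠ ∞ :=
  ne_top_of_le_ne_top (ENNReal.mul_ne_top (ENNReal.div_ne_top (hfin a ha) (by simpa using ha))
    ENNReal.ofReal_ne_top) (setLIntegral_div_le hh ha)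

/-- Up to R only the integral of h/x over (s, 2s] survives, minus that over (R, 2R]. The latter is
dropped here; in the reverse estimate it is at most h(R), which is where the limit 0 enters. -/
theorem lintegral_frullani_le (hh : AntitoneOn h (Ioi 0)) (hfin : ∀ t : ℝ, 0 < t → h t ≠ ∞)
    {s : ℝ} (hs : 0 < s) :
    ∫⁻ x in Ioi s, (h x - h (2 * x)) / ENNReal.ofReal x ≤ h s := by
  rw [setLIntegral_Ioi_eq_iSup_Ioc]
  refine iSup_le fun m => ?_
  refine le_trans ?_ (setLIntegral_div_two_mul_le hh hs)
  have hfin' := setLIntegral_div_ne_top (b := 2 * (s + m)) hh hfin (mul_pos two_pos hs)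
  refine (ENNReal.add_le_add_iff_right hfin').1 ?_
  rw [lintegral_frullani_add hh hs]
  refine (lintegral_mono_set ?_).trans (lintegral_union_le _ _ _)
  intro x hx
  rcases le_or_gt x (2 * s) with h1 | h1
  · exact Or.inl ⟨hx.1, h1⟩
  · exact Or.inr ⟨h1, by linarith [hx.2, hx.1]⟩

theorem le_lintegral_frullani (hh : AntitoneOn h (Ioi 0)) (hfin : ∀ t : ℝ, 0 < t → h t ≠ ∞)
    (hlim : Tendsto h atTop (𝓝 0)) {s : ℝ} (hs : 0 < s) :
    h (2 * s) / 2 ≤ ∫⁻ x in Ioi s, (h x - h (2 * x)) / ENNReal.ofReal x := by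
  refine (le_setLIntegral_div_two_mul hh hs).trans ?_
  have hlim' := (tendsto_const_nhds (x := ∫⁻ x in Ioi s, (h x - h (2 * x)) / ENNReal.ofReal x)).add
    hlim
  rw [add_zero] at hlim'
  refine ge_of_tendsto hlim' ?_
  filter_upwards [eventually_ge_atTop s] with R hR
  have hR0 : 0 < R := hs.trans_le hR
  have hfin' := setLIntegral_div_ne_top (b := 2 * R) hh hfin (mul_pos two_pos hs)
  refine (ENNReal.add_le_add_iff_right hfin').1 ?_
  calc _ = ∫⁻ x in Ioc s (2 * R), h x / ENNReal.ofReal x := by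
        rw [← lintegral_union measurableSet_Ioc (Ioc_disjoint_Ioc_of_le le_rfl),
          Ioc_union_Ioc_eq_Ioc (by linarith) (by linarith)]
    _ ≤ (∫⁻ x in Ioc s R, h x / ENNReal.ofReal x) +
        ∫⁻ x in Ioc R (2 * R), h x / ENNReal.ofReal x := by
        rw [← Ioc_union_Ioc_eq_Ioc hR (show R ≤ 2 * R by linarith)]
        exact lintegral_union_le _ _ _
    _ ≤ ((∫⁻ x in Ioi s, (h x - h (2 * x)) / ENNReal.ofReal x) +
        ∫⁻ x in Ioc (2 * s) (2 * R), h x / ENNReal.ofReal x) + h R := by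
        rw [← lintegral_frullani_add hh hs]
        gcongr
        · exact Ioc_subset_Ioi_self
        · exact setLIntegral_div_two_mul_le hh hR0
    _ = _ := by ring

end Frullani

/-! ### Construction of the weight in (b). -/

section Existence

variable {q : ℝ} {w : ℝ → ℝ≥0}

/-- The decreasing function `(W(x)/x)^{q-1} w(x)`. -/
noncomputable def averagedWeight (q : ℝ) (w : ℝ → ℝ≥0) (x : ℝ) : ℝ≥0∞ :=
  initialAverage (fun s => (w s : ℝ≥0∞)) x ^ (q - 1) * w x

/-- A weight whose `Γ^q` fundamental function is equivalent to that of `Λ¹(w)`. -/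
noncomputable def gammaWeight (q : ℝ) (w : ℝ → ℝ≥0) (x : ℝ) : ℝ≥0 :=
  (ENNReal.ofReal x ^ (q - 1) * (averagedWeight q w x - averagedWeight q w (2 * x))).toNNReal

theorem averagedWeight_antitoneOn (hq : 1 < q) (hdec : AntitoneOn w (Ioi 0)) :
    AntitoneOn (averagedWeight q w) (Ioi 0) := fun _ ha _ hb hab =>
  mul_le_mul' (ENNReal.rpow_le_rpow (initialAverage_antitoneOn (antitoneOn_coe hdec) ha hb hab)
    (by linarith)) (antitoneOn_coe hdec ha hb hab)

theorem initialAverage_coe_ne_top (hw : IsWeight w) {t : ℝ} (ht : 0 < t) :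
    initialAverage (fun s => (w s : ℝ≥0∞)) t ≠ ∞ :=
  ENNReal.mul_ne_top (ENNReal.inv_ne_top.2 (by simpa using ht)) (hw.primitive_ne_top t)

theorem averagedWeight_ne_top (hq : 1 < q) (hw : IsWeight w) {t : ℝ} (ht : 0 < t) :
    averagedWeight q w t ≠ ∞ :=
  ENNReal.mul_ne_top (ENNReal.rpow_ne_top_of_nonneg (by linarith) (initialAverage_coe_ne_top hw ht))
    ENNReal.coe_ne_top

theorem tendsto_averagedWeight (hq : 1 < q) (hw : IsWeight w) (hdec : AntitoneOn w (Ioi 0))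
    (hlim : Tendsto w atTop (𝓝 0)) : Tendsto (averagedWeight q w) atTop (𝓝 0) := by
  have h1 : Tendsto (fun x => (w x : ℝ≥0∞)) atTop (𝓝 0) := by
    rw [← ENNReal.coe_zero]
    exact ENNReal.tendsto_coe.2 hlim
  have h2 := ENNReal.Tendsto.const_mul h1
    (a := initialAverage (fun s => (w s : ℝ≥0∞)) 1 ^ (q - 1)) (Or.inr
      (ENNReal.rpow_ne_top_of_nonneg (by linarith) (initialAverage_coe_ne_top hw one_pos)))
  rw [mul_zero] at h2
  refine tendsto_of_tendsto_of_tendsto_of_le_of_le' tendsto_const_nhds h2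
    (Eventually.of_forall fun _ => zero_le) ?_
  filter_upwards [eventually_ge_atTop 1] with x hx
  have := initialAverage_antitoneOn (antitoneOn_coe hdec) (mem_Ioi.2 one_pos)
    (mem_Ioi.2 (one_pos.trans_le hx)) hx
  unfold averagedWeight
  gcongr

theorem ofReal_rpow_mul_averagedWeight (hq : 1 < q) (x : ℝ) :
    ENNReal.ofReal x ^ (q - 1) * averagedWeight q w x = primitive w x ^ (q - 1) * w x := by
  rw [averagedWeight, ← mul_assoc, ← ENNReal.mul_rpow_of_nonneg _ _ (by linarith),
    ofReal_mul_initialAverage, primitive]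

theorem gammaWeight_div (hq : 1 < q) (hw : IsWeight w) {x : ℝ} (hx : 0 < x) :
    (gammaWeight q w x : ℝ≥0∞) / ENNReal.ofReal x ^ q =
      (averagedWeight q w x - averagedWeight q w (2 * x)) / ENNReal.ofReal x := by
  have hx0 : ENNReal.ofReal x ≠ 0 := by simpa using hx
  rw [gammaWeight, ENNReal.coe_toNNReal (ENNReal.mul_ne_top
    (ENNReal.rpow_ne_top_of_nonneg (by linarith) (by simp))
    (ENNReal.sub_ne_top (averagedWeight_ne_top hq hw hx))), div_eq_mul_inv, ← ENNReal.rpow_neg,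
    mul_right_comm, ← ENNReal.rpow_add _ _ hx0 (by simp), show q - 1 + -q = -1 by ring,
    ENNReal.rpow_neg_one, ENNReal.div_eq_inv_mul]

theorem aemeasurable_gammaWeight (hq : 1 < q) (hdec : AntitoneOn w (Ioi 0)) :
    AEMeasurable (gammaWeight q w) (volume.restrict (Ioi 0)) := by
  have h1 := averagedWeight_antitoneOn hq hdec
  have h2 : AntitoneOn (fun x => averagedWeight q w (2 * x)) (Ioi 0) := fun a ha b hb hab => by
    rw [mem_Ioi] at ha hb
    exact h1 (mem_Ioi.2 (by linarith)) (mem_Ioi.2 (by linarith)) (by linarith)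
  exact ((ENNReal.measurable_ofReal.pow_const _).aemeasurable.mul
    ((aemeasurable_restrict_of_antitoneOn measurableSet_Ioi h1).sub
      (aemeasurable_restrict_of_antitoneOn measurableSet_Ioi h2))).ennreal_toNNReal

/-- The densities compare pointwise: the Frullani tail is at most h(s), and s^{q-1} h(s) =
W(s)^{q-1} w(s). -/
theorem fundamentalFn_gammaWeight_le (hq : 1 < q) (hw : IsWeight w)
    (hdec : AntitoneOn w (Ioi 0)) {r : ℝ} (hr : 0 < r) :
    fundamentalFn q (gammaWeight q w) r ≤ primitive w r ^ q := by
  rw [← lintegral_kernel hq (aemeasurable_gammaWeight hq hdec) hr, primitive_rpow hdec hq]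
  refine setLIntegral_mono' measurableSet_Ioo fun s hs => ?_
  rw [← ofReal_rpow_mul_averagedWeight hq, mul_assoc]
  gcongr
  rw [setLIntegral_congr_fun measurableSet_Ioi fun x hx => gammaWeight_div hq hw (hs.1.trans hx)]
  exact lintegral_frullani_le (averagedWeight_antitoneOn hq hdec)
    (fun t ht => averagedWeight_ne_top hq hw ht) hs.1

/-- The Frullani tail is only bounded below by h(2s)/2, so W(r) is first enlarged to W(2r) and the
variable halved. The constant collects 2 from ds, 2^{q-1} from (2s)^{q-1} and 2 from the halving. -/
theorem primitive_rpow_le_fundamentalFn_gammaWeight (hq : 1 < q) (hw : IsWeight w)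
    (hdec : AntitoneOn w (Ioi 0)) (hlim : Tendsto w atTop (𝓝 0)) {r : ℝ} (hr : 0 < r) :
    primitive w r ^ q ≤ 2 ^ (q + 1) * fundamentalFn q (gammaWeight q w) r := by
  have htwo : (2 : ℝ≥0∞) ≠ ∞ := ENNReal.ofNat_ne_top
  have hpre : (fun x : ℝ => 2 * x) ⁻¹' Ioo 0 (2 * r) = Ioo 0 r := by
    ext x
    simp
  calc primitive w r ^ q ≤ primitive w (2 * r) ^ q := by
        gcongr
        exact monotone_primitive w (by linarith)
    _ = 2 * ∫⁻ s in Ioo 0 r, ENNReal.ofReal q *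
          (primitive w (2 * s) ^ (q - 1) * w (2 * s)) := by
        rw [primitive_rpow hdec hq, setLIntegral_comp_two_mul measurableSet_Ioo, hpre]
    _ ≤ 2 * ∫⁻ s in Ioo 0 r, 2 ^ q * (ENNReal.ofReal q * ENNReal.ofReal s ^ (q - 1) *
          ∫⁻ x in Ioi s, (gammaWeight q w x : ℝ≥0∞) / ENNReal.ofReal x ^ q) := by
        refine mul_le_mul_right (setLIntegral_mono' measurableSet_Ioo fun s hs => ?_) _
        rw [← ofReal_rpow_mul_averagedWeight hq, ENNReal.ofReal_mul zero_le_two,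
          ENNReal.mul_rpow_of_nonneg _ _ (by linarith), setLIntegral_congr_fun measurableSet_Ioi
          fun x hx => gammaWeight_div hq hw (hs.1.trans hx)]
        have hle := le_lintegral_frullani (averagedWeight_antitoneOn hq hdec)
          (fun t ht => averagedWeight_ne_top hq hw ht) (tendsto_averagedWeight hq hw hdec hlim) hs.1
        have h2q : (2 : ℝ≥0∞) ^ q = 2 ^ (q - 1) * 2 := by
          calc (2 : ℝ≥0∞) ^ q = 2 ^ (q - 1 + 1) := by rw [sub_add_cancel]
            _ = _ := by rw [ENNReal.rpow_add _ _ two_ne_zero htwo, ENNReal.rpow_one]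
        calc _ = 2 ^ q * (ENNReal.ofReal q * ENNReal.ofReal s ^ (q - 1) *
              (averagedWeight q w (2 * s) / 2)) := by
              rw [h2q, ENNReal.ofReal_ofNat]
              nth_rewrite 1 [← ENNReal.mul_div_cancel (a := 2) (b := averagedWeight q w (2 * s))
                two_ne_zero htwo]
              ring
          _ ≤ _ := by gcongr
    _ = _ := by
        rw [lintegral_const_mul' _ _ (ENNReal.rpow_ne_top_of_nonneg (by linarith) htwo),
          lintegral_kernel hq (aemeasurable_gammaWeight hq hdec) hr,
          ENNReal.rpow_add _ _ two_ne_zero htwo, ENNReal.rpow_one]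
        ring

theorem exists_fundamentalEquiv (hq : 1 < q) (hw : IsWeight w) (hdec : AntitoneOn w (Ioi 0))
    (hlim : Tendsto w atTop (𝓝 0)) : ∃ u : ℝ → ℝ≥0, IsWeight u ∧ FundamentalEquiv q w u := by
  refine ⟨gammaWeight q w, ⟨aemeasurable_gammaWeight hq hdec, fun t => ?_⟩, 2 ^ (q + 1),
    NNReal.rpow_pos two_pos, fun r hr => ⟨?_, ?_⟩⟩
  · rcases le_or_gt t 0 with ht | ht
    · simp [primitive, Ioo_eq_empty (not_lt.2 ht)]
    · exact ne_top_of_le_ne_top (ENNReal.rpow_ne_top_of_nonneg (by linarith)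
        (hw.primitive_ne_top t)) (le_self_add.trans (fundamentalFn_gammaWeight_le hq hw hdec ht))
  · rw [ENNReal.coe_rpow_of_nonneg _ (by linarith)]
    exact primitive_rpow_le_fundamentalFn_gammaWeight hq hw hdec hlim hr
  · refine (fundamentalFn_gammaWeight_le hq hw hdec hr).trans ?_
    refine le_mul_of_one_le_left' ?_
    rw [ENNReal.one_le_coe_iff]
    exact NNReal.one_le_rpow one_le_two (by linarith)

end Existence

/-! ### Norm estimates from the equivalence of fundamental functions. -/

section Main

variable {n : ℕ} {q : ℝ} {v w : ℝ → ℝ≥0}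

theorem FundamentalEquiv.lintegral_equiv (hq : 1 < q) (hdec : AntitoneOn w (Ioi 0))
    (hv : IsWeight v) (H : FundamentalEquiv q w v) :
    ∃ C : ℝ≥0, 0 < C ∧ ∀ f : EuclideanSpace ℝ (Fin n) → ℝ≥0,
      (∫⁻ x in Ioi (0 : ℝ), maxRearr f x ^ q * (v x : ℝ≥0∞)) ≤
        (C : ℝ≥0∞) * ∫⁻ x in Ioi (0 : ℝ), rearr f x * maxRearr f x ^ (q - 1) *
          primitive w x ^ (q - 1) * (w x : ℝ≥0∞) ∧
      (∫⁻ x in Ioi (0 : ℝ), rearr f x * maxRearr f x ^ (q - 1) *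
          primitive w x ^ (q - 1) * (w x : ℝ≥0∞)) ≤
        (C : ℝ≥0∞) * ∫⁻ x in Ioi (0 : ℝ), maxRearr f x ^ q * (v x : ℝ≥0∞) := by
  obtain ⟨C, hC, H⟩ := H
  have hq1 : 1 ≤ q.toNNReal := by
    rw [← Real.toNNReal_one]
    exact Real.toNNReal_le_toNNReal hq.le
  refine ⟨C * q.toNNReal, mul_pos hC (one_pos.trans_le hq1), fun f => ⟨?_, ?_⟩⟩
  · rw [ENNReal.coe_mul]
    exact lintegral_gamma_le ((antitone_rearr f).antitoneOn _) hq hdec hv.aemeasurable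
      ENNReal.coe_ne_top fun r hr => (H r hr).2
  · refine (le_lintegral_gamma ((antitone_rearr f).antitoneOn _) hq hdec hv.aemeasurable
      ENNReal.coe_ne_top fun r hr => (H r hr).1).trans ?_
    refine mul_le_mul_left (ENNReal.coe_le_coe.2 ?_) _
    exact le_mul_of_one_le_right' hq1

theorem gammaAlphaNorm_powWeight (hw : IsWeight w) (hq : 1 < q)
    (f : EuclideanSpace ℝ (Fin n) → ℝ≥0) :
    gammaAlphaNorm q 1 (powWeight q w) f = (∫⁻ x in Ioi (0 : ℝ), rearr f x *
      maxRearr f x ^ (q - 1) * primitive w x ^ (q - 1) * (w x : ℝ≥0∞)) ^ (1 / q) := by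
  rw [gammaAlphaNorm]
  congr 1
  refine lintegral_congr fun x => ?_
  rw [powWeight, ENNReal.coe_mul, ENNReal.coe_rpow_of_nonneg _ (by linarith),
    ENNReal.coe_toNNReal (hw.primitive_ne_top x), ENNReal.rpow_one, ← mul_assoc]

theorem rpow_one_div_le (hq : 1 < q) {a b : ℝ≥0∞} {C : ℝ≥0} (h : a ≤ C * b) :
    a ^ (1 / q) ≤ (C ^ (1 / q) : ℝ≥0) * b ^ (1 / q) := by
  have hq' : 0 ≤ 1 / q := by
    have : 0 < q := by linarith
    positivity
  rw [ENNReal.coe_rpow_of_nonneg _ hq', ← ENNReal.mul_rpow_of_nonneg _ _ hq']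
  exact ENNReal.rpow_le_rpow h hq'

theorem BoundedBy.space_subset {N M : (EuclideanSpace ℝ (Fin n) → ℝ≥0) → ℝ≥0∞}
    (h : BoundedBy N M) : space M ⊆ space N := by
  obtain ⟨C, hC⟩ := h
  exact fun f hf => ⟨hf.1, (hC f hf.1).trans_lt (ENNReal.mul_lt_top ENNReal.coe_lt_top hf.2)⟩

/-- By Chebyshev (f** W)^{q-1} ≤ L^{q-1} with L the Λ¹(w) norm; what remains under the integral is
f* w, contributing the last factor L. -/
theorem FundamentalEquiv.boundedBy_lambda (hq : 1 < q) (hdec : AntitoneOn w (Ioi 0))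
    (hv : IsWeight v) (H : FundamentalEquiv q w v) :
    BoundedBy (n := n) (gammaNorm q v) (lambdaNorm 1 w) := by
  have hq0 : 0 < q := by linarith
  obtain ⟨C, -, hC⟩ := H.lintegral_equiv (n := n) hq hdec hv
  refine ⟨C ^ (1 / q), fun f _ => ?_⟩
  set L := lambdaNorm 1 w f with hL
  have hL' : L = ∫⁻ x in Ioi 0, rearr f x * w x := lambdaNorm_one_eq f
  have h1 : ∫⁻ x in Ioi (0 : ℝ), rearr f x * maxRearr f x ^ (q - 1) *
      primitive w x ^ (q - 1) * (w x : ℝ≥0∞) ≤ L ^ q := by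
    have hm : AEMeasurable (fun x => rearr f x * (w x : ℝ≥0∞)) (volume.restrict (Ioi 0)) :=
      (antitone_rearr f).measurable.aemeasurable.mul
        (aemeasurable_restrict_of_antitoneOn measurableSet_Ioi (antitoneOn_coe hdec))
    calc _ ≤ ∫⁻ x in Ioi 0, L ^ (q - 1) * (rearr f x * w x) := by
          refine setLIntegral_mono' measurableSet_Ioi fun x hx => ?_
          have h2 := initialAverage_mul_primitive_le ((antitone_rearr f).antitoneOn _) hdec hx
          rw [← hL', ← maxRearr_eq] at h2
          calc _ = (maxRearr f x * primitive w x) ^ (q - 1) * (rearr f x * w x) := by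
                rw [ENNReal.mul_rpow_of_nonneg _ _ (by linarith)]
                ring
            _ ≤ _ := by gcongr
      _ = L ^ (q - 1) * L := by rw [lintegral_const_mul'' _ hm, ← hL']
      _ = L ^ (q - 1) * L ^ (1 : ℝ) := by rw [ENNReal.rpow_one]
      _ = _ := by
          rw [← ENNReal.rpow_add_of_nonneg _ _ (by linarith) zero_le_one, sub_add_cancel]
  have h2 := rpow_one_div_le hq (((hC f).1).trans (mul_le_mul_right h1 _))
  rwa [← ENNReal.rpow_mul, mul_one_div_cancel hq0.ne', ENNReal.rpow_one] at h2

theorem FundamentalEquiv.boundedBy_gammaWeak (hq : 1 < q) (hv : IsWeight v)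
    (H : FundamentalEquiv q w v) :
    BoundedBy (n := n) (gammaWeakNorm 1 w) (gammaNorm q v) := by
  have hq0 : 0 < q := by linarith
  obtain ⟨C, -, hC⟩ := H
  refine ⟨C ^ (1 / q), fun f _ => ?_⟩
  rw [gammaWeakNorm_one_eq]
  refine iSup₂_le fun t ht => ?_
  have h1 : (initialAverage (rearr f) t * primitive w t) ^ q ≤
      C * ∫⁻ x in Ioi (0 : ℝ), maxRearr f x ^ q * (v x : ℝ≥0∞) := by
    calc _ = initialAverage (rearr f) t ^ q * primitive w t ^ q :=
          ENNReal.mul_rpow_of_nonneg _ _ hq0.le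
      _ ≤ initialAverage (rearr f) t ^ q * (C * fundamentalFn q v t) := by
          gcongr
          exact (hC t ht).1
      _ = C * (initialAverage (rearr f) t ^ q * fundamentalFn q v t) := by ring
      _ ≤ _ := by
          gcongr
          exact initialAverage_rpow_mul_fundamentalFn_le ((antitone_rearr f).antitoneOn _) hq
            hv.aemeasurable ht
  have h2 := rpow_one_div_le hq h1
  rwa [← ENNReal.rpow_mul, mul_one_div_cancel hq0.ne', ENNReal.rpow_one] at h2

end Main

end LorentzGamma

theorem mainTheorem6 (n : ℕ) (hn : 0 < n) (q : ℝ) (hq : 1 < q)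
    (w : ℝ → ℝ≥0) (hw : LorentzGamma.IsWeight w) (hdec : AntitoneOn w (Ioi 0)) :
    -- (a)
    (∀ v : ℝ → ℝ≥0, LorentzGamma.IsWeight v →
      LorentzGamma.Lambda n 1 w ⊆ LorentzGamma.Gamma n q v →
      LorentzGamma.Gamma n q v ⊆ LorentzGamma.GammaWeak n 1 w →
        (∃ C : ℝ≥0, 0 < C ∧
          ∀ f : EuclideanSpace ℝ (Fin n) → ℝ≥0, AEMeasurable f volume →
            (∫⁻ x in Ioi (0 : ℝ), LorentzGamma.maxRearr f x ^ q * (v x : ℝ≥0∞)) ≤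
              (C : ℝ≥0∞) * ∫⁻ x in Ioi (0 : ℝ), LorentzGamma.rearr f x *
                LorentzGamma.maxRearr f x ^ (q - 1) *
                  LorentzGamma.primitive w x ^ (q - 1) * (w x : ℝ≥0∞) ∧
            (∫⁻ x in Ioi (0 : ℝ), LorentzGamma.rearr f x *
                LorentzGamma.maxRearr f x ^ (q - 1) *
                  LorentzGamma.primitive w x ^ (q - 1) * (w x : ℝ≥0∞)) ≤
              (C : ℝ≥0∞) *
                ∫⁻ x in Ioi (0 : ℝ), LorentzGamma.maxRearr f x ^ q * (v x : ℝ≥0∞)) ∧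
        LorentzGamma.Gamma n q v =
          LorentzGamma.GammaAlpha n q 1 (LorentzGamma.powWeight q w) ∧
        LorentzGamma.BoundedBy (n := n) (LorentzGamma.gammaNorm q v)
          (LorentzGamma.gammaAlphaNorm q 1 (LorentzGamma.powWeight q w)) ∧
        LorentzGamma.BoundedBy (n := n)
          (LorentzGamma.gammaAlphaNorm q 1 (LorentzGamma.powWeight q w))
          (LorentzGamma.gammaNorm q v)) ∧
    -- (b)
    (Tendsto w atTop (𝓝 0) →
      (∃ wq : ℝ → ℝ≥0, LorentzGamma.IsWeight wq ∧ LorentzGamma.FundamentalEquiv q w wq) ∧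
      ∀ wq : ℝ → ℝ≥0, LorentzGamma.IsWeight wq → LorentzGamma.FundamentalEquiv q w wq →
        LorentzGamma.Lambda n 1 w ⊆ LorentzGamma.Gamma n q wq ∧
        LorentzGamma.Gamma n q wq ⊆ LorentzGamma.GammaWeak n 1 w ∧
        LorentzGamma.BoundedBy (n := n) (LorentzGamma.gammaNorm q wq)
          (LorentzGamma.lambdaNorm 1 w) ∧
        LorentzGamma.BoundedBy (n := n) (LorentzGamma.gammaWeakNorm 1 w)
          (LorentzGamma.gammaNorm q wq)) ∧
    -- (c)
    (∀ c : ℝ≥0, 0 < c → Tendsto w atTop (𝓝 c) →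
      ¬ ∃ v : ℝ → ℝ≥0, LorentzGamma.IsWeight v ∧
        LorentzGamma.Lambda n 1 w ⊆ LorentzGamma.Gamma n q v ∧
        LorentzGamma.Gamma n q v ⊆ LorentzGamma.GammaWeak n 1 w) := by
  refine ⟨fun v hv h₁ h₂ => ?_, fun hlim => ⟨?_, fun wq hwq H => ?_⟩, ?_⟩
  · obtain ⟨C, hC, hf⟩ := (LorentzGamma.fundamentalEquiv_of_subset hn hq hw hdec hv h₁
      h₂).lintegral_equiv (n := n) hq hdec hv
    have hb₁ : LorentzGamma.BoundedBy (n := n) (LorentzGamma.gammaNorm q v)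
        (LorentzGamma.gammaAlphaNorm q 1 (LorentzGamma.powWeight q w)) :=
      ⟨C ^ (1 / q), fun f _ => by
        rw [LorentzGamma.gammaAlphaNorm_powWeight hw hq]
        exact LorentzGamma.rpow_one_div_le hq (hf f).1⟩
    have hb₂ : LorentzGamma.BoundedBy (n := n)
        (LorentzGamma.gammaAlphaNorm q 1 (LorentzGamma.powWeight q w))
        (LorentzGamma.gammaNorm q v) :=
      ⟨C ^ (1 / q), fun f _ => by
        rw [LorentzGamma.gammaAlphaNorm_powWeight hw hq]
        exact LorentzGamma.rpow_one_div_le hq (hf f).2⟩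
    exact ⟨⟨C, hC, fun f _ => hf f⟩, hb₂.space_subset.antisymm hb₁.space_subset, hb₁, hb₂⟩
  · exact LorentzGamma.exists_fundamentalEquiv hq hw hdec hlim
  · have hb₁ := H.boundedBy_lambda (n := n) hq hdec hwq
    have hb₂ := H.boundedBy_gammaWeak (n := n) hq hwq
    exact ⟨hb₁.space_subset, hb₂.space_subset, hb₁, hb₂⟩
  · rintro c hc hlim ⟨v, hv, h₁, h₂⟩
    exact LorentzGamma.not_fundamentalEquiv_of_tendsto_pos hq hw hdec hv hc hlim
      (LorentzGamma.fundamentalEquiv_of_subset hn hq hw hdec hv h₁ h₂)
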